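/- \textbf{Conventions.} Rings are associative, not necessarily unital; commutative rings are unital and carry the trivial involution. An involution on a ring $R$ is an additive map $x\mapsto\bar x$ with $\overline{xy}=\bar y\bar x$ and $\bar{\bar x}=x$. \textbf{Odd form rings and algebras.} An \emph{odd form ring} $(R,\Delta)$ consists of a ring $R$ with involution, a group $\Delta$ (written additively with $\dotplus$, not necessarily commutative) with a right action $(u,x)\mapsto u\cdot x$ of the multiplicative semigroup of $R$ by group endomorphisms, group homomorphisms $\phi\colon R\to\Delta$ and $\pi\colon\Delta\to R$, and a map $\rho\colon\Delta\to R$, such that for all $u,v\in\Delta$, $x,y\in R$: $\pi(u\cdot x)=\pi(u)x$; $\phi(\bar xyx)=\phi(y)\cdot x$; $\phi(x)=\dot0$ if $\bar x=x$; $u\dotplus\phi(x)=\phi(x)\dotplus u$; $u\dotplus v=v\dotplus u\dotplus\phi(-\overline{\pi(u)}\pi(v))$; $\rho(u\dotplus v)=\rho(u)-\overline{\pi(u)}\pi(v)+\rho(v)$; $\overline{\rho(u)}=\rho(\dot- u)$; $\rho(u\cdot x)=\bar x\rho(u)x$; $\pi(\phi(x))=0$; $\rho(\phi(x))=x-\bar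 x$; $u\cdot(x+y)=u\cdot x\dotplus\phi(\bar y\rho(u)x)\dotplus u\cdot y$. It is \emph{unital} if $R$ is unital and $u\cdot1=u$ for all $u$. For a commutative ring $K$, $(R,\Delta)$ is an \emph{odd form $K$-algebra} if $R$ is a $K$-algebra with $K$-linear involution and the structure extends to a unital odd form ring $(R\rtimes K,\Delta)$, where $R\rtimes K=R\oplus K$ is the unitization of $R$. It is \emph{quasi-finite} if $R$ is a direct limit of $K$-algebras that are finitely generated $K$-modules. \textbf{Hyperbolic families.} A \emph{hyperbolic pair} is $\eta=(e_-,e_+,q_-,q_+)$ with $e_\pm\in R$ orthogonal idempotents, $\overline{e_+}=e_-$, and $q_\pm\in\Delta$ with $\pi(q_\pm)=e_\pm$, $\rho(q_\pm)=0$, $q_\pm\cdot e_\pm=q_\pm$. An \emph{orthogonal hyperbolic family} of rank $n$ is a family $\eta_i=(e_{-i},e_i,q_{-i},q_i)$, $1\le i\le n$, of hyperbolic pairs such that, with $e_{|i|}=e_{-i}+e_i$, one has $e_{|i|}e_{|j|}=0$ for $i\ne j$ and $e_{|i|}Re_{|j|}Re_{|i|}=e_{|i|}Re_{|i|}$ for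 all $i,j$ (products denote additive spans). It is \emph{free} if there are $e_{ij}\in R$, $1\le i,j\le n$, with $e_{ii}=e_i$ and $e_{ij}e_{jk}=e_{ik}$ for all $i,j,k$. Write $R_{ij}=e_iRe_j$, $R_i=R_{ii}$ (a ring with unit $e_i$), $e_{0'}=\sum_{i=1}^n e_{|i|}$, and $\Delta^{\mathrm{ev}}=\{\rho(u)\mid u\in\Delta\cdot e_{0'},\ \pi(u)=0\}\subseteq R$. \textbf{Stable ranks.} A finite sequence $(x_i)$ in $R_1$ is \emph{right unimodular} if $\sum_i y_ix_i=e_1$ for some $y_i\in R_1$. For an integer $k\ge1$, $\mathrm{sr}(R_1)\le k-1$ means: for every right unimodular $x_1,\dots,x_k\in R_1$ there are $a_1,\dots,a_{k-1}\in R_1$ such that $x_1+a_1x_k,\dots,x_{k-1}+a_{k-1}x_k$ is right unimodular. And $\Lambda\mathrm{sr}(\eta_1;R,\Delta)\le k-1$ means that $\mathrm{sr}(R_1)\le k-1$ and for all $x_1,\dots,x_k\in R_1$, $x_{-k},\dots,x_{-1}\in R_{-1,1}$ for which there exist $y_1,\dots,y_k\in R_1$, $y_{-k},\dots,y_{-1}\in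 R_{1,-1}$ with $\sum_iy_ix_i=e_1$, there are $a_{ij}\in R_{1,-1}$ ($1\le i\le k$, $-k\le j\le-1$) with $a_{ij}=-\overline{a_{-j,-i}}$ and $a_{i,-i}\in\Delta^{\mathrm{ev}}$ such that the sequence $x_i+\sum_{j=-k}^{-1}a_{ij}x_j$, $1\le i\le k$, is right unimodular in $R_1$. The condition $\Lambda\mathrm{sr}(\eta_1;R,\Delta)\le\infty$ is vacuous. \textbf{Bass--Serre dimension.} For $d\in\{-\infty,0,1,\dots,+\infty\}$, $\mathrm{BS}(K)\le d$ means that the space $\mathrm{Max}(K)$ of maximal ideals with the Zariski topology is a finite union of irreducible (in particular nonempty) Noetherian subspaces of dimension at most $d$; thus $\mathrm{BS}(K)\le-\infty$ if and only if $K=0$. Put $-\infty+1=0$. \textbf{Theorem.} Let $K$ be a commutative ring, $(R,\Delta)$ a quasi-finite odd form $K$-algebra with a free orthogonal hyperbolic family $\eta_1,\dots,\eta_n$ of rank $n\ge1$, and $d\in\{-\infty,0,1,\dots,+\infty\}$. If $\mathrm{BS}(K)\le d$, then $\Lambda\mathrm{sr}(\eta_1;R,\Delta)\le d+1$. -/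

import Mathlib

universe u v w

/-- An odd form ring `(R, Δ)`: `R` is a (possibly non-unital) ring with involution `star`, `Δ` is a
(not necessarily commutative) group written additively, with a right action of the multiplicative
semigroup of `R` by group endomorphisms and with maps `φ : R → Δ`, `π : Δ → R`, `ρ : Δ → R`. -/
structure OddFormRing (R : Type v) (Δ : Type w) [NonUnitalRing R] [StarRing R] [AddGroup Δ] where
  /-- the right action `u · x` -/
  act : Δ → R → Δ
  phi : R →+ Δ
  pi : Δ →+ R
  rho : Δ → R
  act_mul : ∀ u x y, act u (x * y) = act (act u x) y
  add_act : ∀ u v x, act (u + v) x = act u x + act v x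
  pi_act : ∀ u x, pi (act u x) = pi u * x
  phi_conj : ∀ x y, phi (star x * y * x) = act (phi y) x
  phi_of_hermitian : ∀ x, star x = x → phi x = 0
  add_phi_comm : ∀ u x, u + phi x = phi x + u
  add_swap : ∀ u v, u + v = v + u + phi (-(star (pi u) * pi v))
  rho_add : ∀ u v, rho (u + v) = rho u - star (pi u) * pi v + rho v
  star_rho : ∀ u, star (rho u) = rho (-u)
  rho_act : ∀ u x, rho (act u x) = star x * rho u * x
  pi_phi : ∀ x, pi (phi x) = 0
  rho_phi : ∀ x, rho (phi x) = x - star x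
  act_add : ∀ u x y, act u (x + y) = act u x + phi (star y * rho u * x) + act u y

/-- An odd form `K`-algebra `(R, Δ)`: an odd form ring such that `R` is an involution `K`-algebra
and the structure extends to a unital odd form ring `(R ⋊ K, Δ)`, where `R ⋊ K` is the
unitization of `R` (and `K` carries the trivial involution). -/
structure OddFormAlgebra (K : Type u) (R : Type v) (Δ : Type w) [CommRing K] [StarRing K]
    [TrivialStar K] [NonUnitalRing R] [StarRing R] [Module K R] [IsScalarTower K R R]
    [SMulCommClass K R R] [StarModule K R] [AddGroup Δ] extends OddFormRing R Δ where
  /-- the odd form ring `(R ⋊ K, Δ)` -/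
  unitized : OddFormRing (Unitization K R) Δ
  unitized_act : ∀ u (x : R), unitized.act u (x : Unitization K R) = act u x
  unitized_phi : ∀ x : R, unitized.phi (x : Unitization K R) = phi x
  unitized_pi : ∀ u, unitized.pi u = (pi u : Unitization K R)
  unitized_rho : ∀ u, unitized.rho u = (rho u : Unitization K R)
  unitized_act_one : ∀ u, unitized.act u 1 = u

/-- A presentation of a (non-unital) `K`-algebra `R` as the direct limit, over a nonempty directed
set, of `K`-algebras that are finitely generated as `K`-modules. -/
structure FiniteAlgebraLimit (K : Type u) (R : Type v) [CommRing K] [NonUnitalRing R]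
    [Module K R] where
  ι : Type v
  [preorder : Preorder ι]
  [nonempty : Nonempty ι]
  directed : ∀ i j : ι, ∃ k, i ≤ k ∧ j ≤ k
  /-- the algebras of the system -/
  A : ι → Type v
  [ring : ∀ i, NonUnitalRing (A i)]
  [module : ∀ i, Module K (A i)]
  [tower : ∀ i, IsScalarTower K (A i) (A i)]
  [comm : ∀ i, SMulCommClass K (A i) (A i)]
  finite : ∀ i, Module.Finite K (A i)
  /-- the transition maps -/
  map : ∀ {i j : ι}, i ≤ j → (A i →ₙₐ[K] A j)
  map_self : ∀ i (x : A i), map (le_refl i) x = x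
  map_map : ∀ {i j k : ι} (hij : i ≤ j) (hjk : j ≤ k) (x : A i),
    map hjk (map hij x) = map (hij.trans hjk) x
  /-- the canonical maps to the limit -/
  toLimit : ∀ i, A i →ₙₐ[K] R
  toLimit_map : ∀ {i j : ι} (hij : i ≤ j) (x : A i), toLimit j (map hij x) = toLimit i x
  exists_toLimit : ∀ r : R, ∃ i, ∃ x : A i, toLimit i x = r
  eq_of_toLimit_eq : ∀ i (x y : A i), toLimit i x = toLimit i y →
    ∃ j, ∃ hij : i ≤ j, map hij x = map hij y

/-- A `K`-algebra is quasi-finite if it is a direct limit of finite `K`-algebras. -/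
def IsQuasiFiniteAlgebra (K : Type u) (R : Type v) [CommRing K] [NonUnitalRing R]
    [Module K R] : Prop :=
  Nonempty (FiniteAlgebraLimit K R)

/-- An odd form `K`-algebra `(R, Δ)` is quasi-finite if `R` is a quasi-finite `K`-algebra. -/
def OddFormAlgebra.IsQuasiFinite {K : Type u} {R : Type v} {Δ : Type w} [CommRing K] [StarRing K]
    [TrivialStar K] [NonUnitalRing R] [StarRing R] [Module K R] [IsScalarTower K R R]
    [SMulCommClass K R R] [StarModule K R] [AddGroup Δ] (_D : OddFormAlgebra K R Δ) : Prop :=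
  IsQuasiFiniteAlgebra K R

section Families

variable {R : Type v} {Δ : Type w} [NonUnitalRing R] [StarRing R] [AddGroup Δ]

/-- A hyperbolic pair `η = (e₋, e₊, q₋, q₊)` in an odd form ring. -/
structure HyperbolicPair (D : OddFormRing R Δ) where
  em : R
  ep : R
  qm : Δ
  qp : Δ
  em_mul_em : em * em = em
  ep_mul_ep : ep * ep = ep
  em_mul_ep : em * ep = 0
  ep_mul_em : ep * em = 0
  star_ep : star ep = em
  pi_qm : D.pi qm = em
  rho_qm : D.rho qm = 0
  act_qm : D.act qm em = qm
  pi_qp : D.pi qp = ep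
  rho_qp : D.rho qp = 0
  act_qp : D.act qp ep = qp

/-- The hermitian idempotent `e₋ + e₊` of a hyperbolic pair. -/
def HyperbolicPair.eabs {D : OddFormRing R Δ} (η : HyperbolicPair D) : R := η.em + η.ep

/-- Two hyperbolic pairs are orthogonal if their hermitian idempotents are orthogonal. -/
def HyperbolicPair.Orthogonal {D : OddFormRing R Δ} (η θ : HyperbolicPair D) : Prop :=
  η.eabs * θ.eabs = 0 ∧ θ.eabs * η.eabs = 0

/-- Morita equivalence: `e R f R e = e R e` and `f R e R f = f R f` for the hermitian idempotents
`e` and `f` of the two pairs; the products denote the additive subgroups spanned by the products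
of elements. -/
def HyperbolicPair.MoritaEquivalent {D : OddFormRing R Δ} (η θ : HyperbolicPair D) : Prop :=
  (AddSubgroup.closure {z | ∃ x y : R, z = η.eabs * x * θ.eabs * y * η.eabs} : Set R)
      = {z | ∃ x : R, z = η.eabs * x * η.eabs} ∧
    (AddSubgroup.closure {z | ∃ x y : R, z = θ.eabs * x * η.eabs * y * θ.eabs} : Set R)
      = {z | ∃ x : R, z = θ.eabs * x * θ.eabs}

/-- An orthogonal hyperbolic family of rank `n`: pairwise orthogonal and Morita equivalent
hyperbolic pairs (indexed by `0, …, n - 1`). -/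
structure OrthogonalHyperbolicFamily (D : OddFormRing R Δ) (n : ℕ) where
  pair : Fin n → HyperbolicPair D
  orthogonal : ∀ i j, i ≠ j → (pair i).Orthogonal (pair j)
  morita : ∀ i j, (pair i).MoritaEquivalent (pair j)

/-- The family is free if its members are isomorphic in a coherent way: there are `e i j` with
`e i i = e_i` and `e i j * e j k = e i k`. -/
def OrthogonalHyperbolicFamily.IsFree {D : OddFormRing R Δ} {n : ℕ}
    (F : OrthogonalHyperbolicFamily D n) : Prop :=
  ∃ e : Fin n → Fin n → R, (∀ i, e i i = (F.pair i).ep) ∧ ∀ i j k, e i j * e j k = e i k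

/-- The sum of all the idempotents of the family (the complement of `e_0`). -/
def OrthogonalHyperbolicFamily.esum {D : OddFormRing R Δ} {n : ℕ}
    (F : OrthogonalHyperbolicFamily D n) : R := ∑ i, (F.pair i).eabs

/-- The even form parameter: the image under `ρ` of the kernel of `π` on `Δ · e`, where `e` is
the sum of all the idempotents of the family. -/
def OrthogonalHyperbolicFamily.evenParameter {D : OddFormRing R Δ} {n : ℕ}
    (F : OrthogonalHyperbolicFamily D n) : Set R :=
  {r | ∃ v : Δ, D.pi (D.act v F.esum) = 0 ∧ D.rho (D.act v F.esum) = r}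

/-- The set `e R f`. -/
def peirceBlock (e f : R) : Set R := {x | ∃ r : R, x = e * r * f}

/-- Right unimodularity of a finite sequence in the unital ring `e R e`. -/
def IsRightUnimodular (e : R) {k : ℕ} (x : Fin k → R) : Prop :=
  ∃ y : Fin k → R, (∀ i, y i ∈ peirceBlock e e) ∧ ∑ i, y i * x i = e

/-- The condition `sr(e R e) ≤ m` on the unital ring `e R e`. -/
def StableRankLE (e : R) (m : ℕ) : Prop :=
  ∀ x : Fin (m + 1) → R, (∀ i, x i ∈ peirceBlock e e) → IsRightUnimodular e x →
    ∃ a : Fin m → R, (∀ i, a i ∈ peirceBlock e e) ∧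
      IsRightUnimodular e (fun i : Fin m => x i.castSucc + a i * x (Fin.last m))

/-- The condition `Λsr(η; R, Δ) ≤ m` for a member `η = η_s` of the family. A sequence
`x_{-k}, …, x_{-1}, x_1, …, x_k` with `k = m + 1` is given by `xp i = x_{i + 1}` and
`xm i = x_{-(i + 1)}`, and the entry `A i j` stands for `a_{i + 1, -(j + 1)}`. -/
def OrthogonalHyperbolicFamily.LambdaStableRankLENat {D : OddFormRing R Δ} {n : ℕ}
    (F : OrthogonalHyperbolicFamily D n) (s : Fin n) (m : ℕ) : Prop :=
  StableRankLE (F.pair s).ep m ∧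
  ∀ xm xp : Fin (m + 1) → R,
    (∀ i, xm i ∈ peirceBlock (F.pair s).em (F.pair s).ep) →
    (∀ i, xp i ∈ peirceBlock (F.pair s).ep (F.pair s).ep) →
    (∃ ym yp : Fin (m + 1) → R,
      (∀ i, ym i ∈ peirceBlock (F.pair s).ep (F.pair s).em) ∧
      (∀ i, yp i ∈ peirceBlock (F.pair s).ep (F.pair s).ep) ∧
      ∑ i, ym i * xm i + ∑ i, yp i * xp i = (F.pair s).ep) →
    ∃ A : Fin (m + 1) → Fin (m + 1) → R,
      (∀ i j, A i j ∈ peirceBlock (F.pair s).ep (F.pair s).em) ∧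
      (∀ i j, A i j = -star (A j i)) ∧
      (∀ i, A i i ∈ F.evenParameter) ∧
      IsRightUnimodular (F.pair s).ep (fun i => xp i + ∑ j, A i j * xm j)

/-- The condition `Λsr(η_s; R, Δ) ≤ M` for `M` in `{0, 1, …, ∞}` (no condition if `M = ∞`). -/
def OrthogonalHyperbolicFamily.LambdaStableRankLE {D : OddFormRing R Δ} {n : ℕ}
    (F : OrthogonalHyperbolicFamily D n) (s : Fin n) (M : ℕ∞) : Prop :=
  ∀ m : ℕ, M = (m : ℕ∞) → F.LambdaStableRankLENat s m

end Families

/-- `BS(K) ≤ d`: the maximal spectrum of `K` with the Zariski topology is a finite union of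
irreducible Noetherian subspaces of dimension at most `d`. Irreducible sets are nonempty, so
`BS(K) ≤ ⊥` holds exactly for the zero ring. -/
def BassSerreDimLE (K : Type u) [CommRing K] (d : WithBot ℕ∞) : Prop :=
  ∃ S : Set (Set (MaximalSpectrum K)), S.Finite ∧ ⋃₀ S = Set.univ ∧
    ∀ X ∈ S, IsIrreducible X ∧ TopologicalSpace.NoetherianSpace X ∧ topologicalKrullDim X ≤ d

/-- `d + 1` for `d` in `{-∞, 0, 1, …, +∞}`, with the convention `-∞ + 1 = 0`. -/
def dimSucc : WithBot ℕ∞ → ℕ∞ := WithBot.recBotCoe 0 (fun d => d + 1)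

/-! Matrices of the special form `B - B^*` suffice: they are skew, and a diagonal entry `b - star b`
equals `ρ(φ(b))`, hence lies in the even form parameter. Quasi-finiteness places all data in an
involution subalgebra `R₀` finite over `K`. With `e = e_1`, put `A = e R₀ e` and `N = e R₀ ē`, a
left `A`-module with involution. The `x_i` become a vector `z` over `A`, the `x_{-i}` become maps
`w_i : N → A` by right multiplication, and `z + (B - B^*) w` has to generate `A` as a left ideal.

This is proved modulo an auxiliary left ideal `L`, by induction on the height of `badLocus K L`, the
closed set of maximal ideals at which `L` is proper (`isReducible_of_bassSerreSmall`). A height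
bound supplies a finite set `T` such that closed subsets avoiding `T` have smaller height.
Transvections and Siegel moves make `z 0` generate the unit ideal modulo `L` at every point of `T`.
Then `L + A z_0` has a smaller bad locus, and the induction applies to the remaining entries, once
`w 0` has been made superfluous. The ordinary stable range theorem
(`exists_sup_span_range_add_eq_top`) does this, by a Siegel move divisible by a scalar `c` that
vanishes on `T`, so that nothing gained on `T` is lost.

The local input is `IsSemisimpleRing.exists_sup_span_lt`. In the semisimple residue algebra at a
maximal ideal, take a reachable state for which the image of `L + A z_0` is maximal. By the lemma
this image contains every left ideal of available changes of `z 0`; these turn out to give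
everything, so the image is the whole ring, and Nakayama lifts this back to `A`. -/

/-! ### Heights of closed sets in the maximal spectrum. -/

section BassSerre

open Topology TopologicalSpace

/-- `Z` has Bass–Serre height less than `r`: either `r = 0` and `Z` is empty, or there is a finite
set of points such that every closed subset of `Z` avoiding it has height less than `r - 1`. -/
def BassSerreSmall {M : Type*} [TopologicalSpace M] : ℕ → Set M → Prop
  | 0, Z => Z = ∅
  | r + 1, Z => ∃ T : Set M, T.Finite ∧ ∀ Z', IsClosed Z' → Z' ⊆ Z → Disjoint Z' T →
      BassSerreSmall r Z'

theorem BassSerreSmall.mono {M : Type*} [TopologicalSpace M] {r : ℕ} {Z Z' : Set M}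
    (h : BassSerreSmall r Z) (hZ : Z' ⊆ Z) : BassSerreSmall r Z' := by
  cases r with
  | zero => exact Set.subset_eq_empty hZ h
  | succ r =>
    obtain ⟨T, hT, hTZ⟩ := h
    exact ⟨T, hT, fun W hW hWZ hWT => hTZ W hW (hWZ.trans hZ) hWT⟩

/-- A closed subspace that misses a point of every irreducible component has smaller dimension. -/
theorem topologicalKrullDim_lt_of_isClosedEmbedding {X Y : Type*} [TopologicalSpace X]
    [TopologicalSpace Y] {f : Y → X} (hf : IsClosedEmbedding f)
    (hT : ∀ C ∈ irreducibleComponents X, ∃ t ∈ C, t ∉ Set.range f) {r : ℕ}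
    (hX : topologicalKrullDim X < (r + 1 : ℕ)) : topologicalKrullDim Y < r := by
  by_contra! h
  obtain ⟨p, hp⟩ := Order.le_krullDim_iff.1 h
  let q := p.map _ (IrreducibleCloseds.map_strictMono_of_isInducing hf.isInducing)
  -- The chain pushed forward from `Y` stays inside the closed range of `f`, so a component
  -- containing its last term is strictly larger and lengthens the chain by one.
  obtain ⟨C, hC, hCs⟩ := exists_mem_irreducibleComponents_subset_of_isIrreducible
    (q.last : Set X) q.last.isIrreducible
  let c : IrreducibleCloseds X := ⟨C, hC.1, isClosed_of_mem_irreducibleComponents C hC⟩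
  have hlt : q.last < c := by
    refine lt_of_le_of_ne hCs fun heq => ?_
    obtain ⟨t, htC, ht⟩ := hT C hC
    have h1 : (q.last : Set X) ⊆ Set.range f := by
      rw [LTSeries.last_map, IrreducibleCloseds.coe_map]
      exact closure_minimal (Set.image_subset_range _ _) hf.isClosed_range
    exact ht (h1 (by rw [heq]; exact htC))
  have : ((q.snoc c hlt).length : WithBot ℕ∞) ≤ topologicalKrullDim X :=
    Order.LTSeries.length_le_krullDim _
  refine absurd (this.trans_lt hX) ?_
  simp [q, hp]

/-- Take for `T` one point in each irreducible component of each `Z ∩ X`; there are finitely many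
because `X` is Noetherian. A closed `Z' ⊆ Z` avoiding `T` misses a point of every component, so each
`Z' ∩ X` drops in dimension. -/
theorem bassSerreSmall_of_topologicalKrullDim_lt {M : Type*} [TopologicalSpace M]
    (S : Set (Set M)) (hS : S.Finite) (hU : ⋃₀ S = Set.univ)
    (hN : ∀ X ∈ S, NoetherianSpace X) (r : ℕ) (Z : Set M) (hZ : IsClosed Z)
    (hdim : ∀ X ∈ S, topologicalKrullDim ↥(Z ∩ X) < r) : BassSerreSmall r Z := by
  induction r generalizing Z with
  | zero =>
    refine Set.eq_empty_of_forall_notMem fun z hz => ?_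
    obtain ⟨X, hX, hzX⟩ := Set.mem_sUnion.1 (hU ▸ Set.mem_univ z)
    have : Nonempty ↥(Z ∩ X) := ⟨⟨z, hz, hzX⟩⟩
    have h0 : Nonempty (IrreducibleCloseds ↥(Z ∩ X)) :=
      ⟨⟨irreducibleComponent ⟨z, hz, hzX⟩, isIrreducible_irreducibleComponent,
        isClosed_irreducibleComponent⟩⟩
    exact absurd (hdim X hX) (not_lt.2 (Order.krullDim_nonneg))
  | succ r ih =>
    have hcomp : ∀ X : Set M, X ∈ S → (irreducibleComponents ↥(Z ∩ X)).Finite := fun X hX => by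
      have := hN X hX
      have : NoetherianSpace ↥(Z ∩ X) := NoetherianSpace.inter_of_right Z X
      exact NoetherianSpace.finite_irreducibleComponents
    have hne : ∀ (X : Set M) (C : Set ↥(Z ∩ X)), ∃ t : Set M, t.Finite ∧
        (C ∈ irreducibleComponents ↥(Z ∩ X) → ∃ y ∈ C, (y : M) ∈ t) := fun X C => by
      by_cases hC : C ∈ irreducibleComponents ↥(Z ∩ X)
      · obtain ⟨y, hy⟩ := hC.1.nonempty
        exact ⟨{(y : M)}, Set.finite_singleton _, fun _ => ⟨y, hy, rfl⟩⟩
      · exact ⟨∅, Set.finite_empty, fun h => absurd h hC⟩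
    choose t ht htm using hne
    refine ⟨⋃ X ∈ S, ⋃ C ∈ irreducibleComponents ↥(Z ∩ X), t X C,
      hS.biUnion fun X hX => (hcomp X hX).biUnion fun C _ => ht X C, fun Z' hZ' hsub hd => ?_⟩
    refine ih Z' hZ' fun X hX => ?_
    have hsub' : Z' ∩ X ⊆ Z ∩ X := Set.inter_subset_inter_left X hsub
    have hemb : IsClosedEmbedding (Set.inclusion hsub') := by
      refine ⟨IsEmbedding.inclusion hsub', ?_⟩
      rw [Set.range_inclusion]
      have : {x : ↥(Z ∩ X) | (x : M) ∈ Z' ∩ X} = Subtype.val ⁻¹' Z' := by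
        ext x
        exact ⟨fun h => h.1, fun h => ⟨h, x.2.2⟩⟩
      rw [this]
      exact hZ'.preimage continuous_subtype_val
    refine topologicalKrullDim_lt_of_isClosedEmbedding hemb (fun C hC => ?_) (hdim X hX)
    obtain ⟨y, hy, hyt⟩ := htm X C hC
    refine ⟨y, hy, ?_⟩
    rintro ⟨z, rfl⟩
    exact Set.disjoint_left.1 hd z.2.1 (Set.mem_biUnion hX (Set.mem_biUnion hC hyt))

/-- The strict bound `dim < m` treats all cases alike: `m = 0` for `d = -∞`, `m = d + 1` for finite
`d`, while `d = +∞` contradicts finiteness of `m`. -/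
theorem BassSerreDimLE.bassSerreSmall_univ {K : Type*} [CommRing K] {d : WithBot ℕ∞}
    (h : BassSerreDimLE K d) {m : ℕ} (hm : dimSucc d = m) :
    BassSerreSmall m (Set.univ : Set (MaximalSpectrum K)) := by
  obtain ⟨S, hS, hU, hX⟩ := h
  refine bassSerreSmall_of_topologicalKrullDim_lt S hS hU (fun X h => (hX X h).2.1) m _
    isClosed_univ fun X h => ?_
  rw [Set.univ_inter]
  refine (hX X h).2.2.trans_lt ?_
  induction d with
  | bot => exact WithBot.bot_lt_coe _
  | coe d =>
    change d + 1 = (m : ℕ∞) at hm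
    induction d with
    | top => simp at hm
    | coe d =>
      have : d + 1 = m := by exact_mod_cast hm
      subst this
      exact_mod_cast Nat.lt_succ_self d

end BassSerre

/-! ### Semisimple rings and residue algebras. -/

/-- Over a semisimple ring, a cyclic submodule of a cyclic module `P` can be enlarged by changing
its generator by an element of any given submodule of `P` that it does not contain. -/
theorem IsSemisimpleRing.exists_span_lt_span_add {B P : Type*} [Ring B] [IsSemisimpleRing B]
    [AddCommGroup P] [Module B P] (f : B →ₗ[B] P) (hf : Function.Surjective f) (z : P)
    (Y : Submodule B P) (hY : ¬ Y ≤ Submodule.span B {z}) :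
    ∃ y ∈ Y, Submodule.span B {z} < Submodule.span B {z + y} := by
  obtain ⟨U, hU1, hU2⟩ : ∃ U : Submodule B P, Disjoint (Y ⊓ Submodule.span B {z}) U ∧
      (Y ⊓ Submodule.span B {z}) ⊔ U = Y := by
    obtain ⟨V, hV⟩ := exists_isCompl (Y ⊓ Submodule.span B {z})
    refine ⟨V ⊓ Y, hV.disjoint.mono_right inf_le_left, ?_⟩
    rw [← sup_inf_assoc_of_le V (inf_le_left : Y ⊓ Submodule.span B {z} ≤ Y), hV.sup_eq_top,
      top_inf_eq]
  have hU0 : U ≠ ⊥ := by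
    rintro rfl
    rw [sup_bot_eq, inf_eq_left] at hU2
    exact hY hU2
  -- A simple submodule of `Y` that meets `B z` trivially.
  obtain ⟨S, hS, hSU⟩ := (eq_bot_or_exists_atom_le U).resolve_left hU0
  have hSY : S ≤ Y := hSU.trans (hU2 ▸ le_sup_right)
  have hdisj : Disjoint S (Submodule.span B {z}) := by
    rw [disjoint_iff, eq_bot_iff, ← hU1.eq_bot]
    exact le_inf (inf_le_inf_right _ hSY) (inf_le_left.trans hSU)
  -- If `a` kills `z` but not `y ∈ S`, then `a (z + y) = a y` generates the simple module `S`, so `B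
  -- (z + y)` contains both `S` and `z`.
  by_cases h : ∃ a : B, a • z = 0 ∧ ∃ y ∈ S, a • y ≠ 0
  · obtain ⟨a, haz, y, hy, hay⟩ := h
    have h1 : a • y ∈ Submodule.span B {z + y} := by
      rw [← zero_add (a • y), ← haz, ← smul_add]
      exact Submodule.smul_mem _ _ (Submodule.mem_span_singleton_self _)
    have hS1 : S ≤ Submodule.span B {z + y} := by
      have h2 : Submodule.span B {a • y} ≤ S :=
        (Submodule.span_singleton_le_iff_mem _ _).2 (S.smul_mem _ hy)
      have h3 : Submodule.span B {a • y} = S :=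
        (hS.le_iff.1 h2).resolve_left (by simpa using hay)
      rw [← h3, Submodule.span_singleton_le_iff_mem]
      exact h1
    have hz : z ∈ Submodule.span B {z + y} := by
      have := Submodule.sub_mem _ (Submodule.mem_span_singleton_self (R := B) (z + y)) (hS1 hy)
      simpa using this
    refine ⟨y, hSY hy, lt_of_le_of_ne ((Submodule.span_singleton_le_iff_mem _ _).2 hz) ?_⟩
    intro heq
    rw [← heq] at hS1
    exact hS.1 (hdisj.eq_bot_of_le hS1)
  -- Otherwise `ann z` lies in the two-sided ideal `M = ann S`, so `B z` maps onto `B / M` and the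
  -- cyclic module `P` maps onto `(B / M) × S`. This is too large for a quotient of `B` killed by
  -- `M`.
  · push Not at h
    exfalso
    let M : Ideal B := Module.annihilator B S
    have hM : ∀ a : B, a • z = 0 → a ∈ M := fun a ha => by
      rw [Module.mem_annihilator]
      rintro ⟨y, hy⟩
      exact Subtype.ext (h a ha y hy)
    let g := LinearMap.toSpanSingleton B P z
    have hg : LinearMap.range g = Submodule.span B {z} := LinearMap.range_toSpanSingleton z
    rw [← hg] at hdisj
    obtain ⟨V, hV⟩ := exists_isCompl (S ⊔ LinearMap.range g)
    have hc1 : IsCompl S (LinearMap.range g ⊔ V) := by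
      refine IsCompl.mk ?_ ?_
      · exact Disjoint.disjoint_sup_right_of_disjoint_sup_left hdisj hV.disjoint
      · rw [codisjoint_iff, ← sup_assoc, hV.sup_eq_top]
    have hc2 : IsCompl (LinearMap.range g) (S ⊔ V) := by
      refine IsCompl.mk ?_ ?_
      · exact Disjoint.disjoint_sup_right_of_disjoint_sup_left hdisj.symm (by
          rw [sup_comm]; exact hV.disjoint)
      · rw [codisjoint_iff, ← sup_assoc, sup_comm (LinearMap.range g), hV.sup_eq_top]
    have hker : LinearMap.ker g ≤ Submodule.comap LinearMap.id M := fun a ha =>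
      hM a (by simpa [g] using ha)
    let ψ : P →ₗ[B] B ⧸ M := (Submodule.mapQ _ M LinearMap.id hker).comp
      (g.quotKerEquivRange.symm.toLinearMap.comp (Submodule.projectionOnto _ _ hc2))
    have hψ : ∀ b, ψ (g b) = Submodule.Quotient.mk b := fun b => by
      have h1 : Submodule.projectionOnto _ _ hc2 (g b) = ⟨g b, b, rfl⟩ :=
        Submodule.projectionOnto_apply_left hc2 ⟨g b, b, rfl⟩
      have h2 : g.quotKerEquivRange.symm ⟨g b, b, rfl⟩ = Submodule.Quotient.mk b := by
        rw [LinearEquiv.symm_apply_eq]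
        rfl
      simp only [ψ, LinearMap.comp_apply, h1, LinearEquiv.coe_coe, h2]
      rfl
    have hψS : ∀ y ∈ S, ψ y = 0 := fun y hy => by
      have h1 : Submodule.projectionOnto _ _ hc2 y = 0 :=
        Submodule.projectionOnto_apply_right hc2 ⟨y, Submodule.mem_sup_left hy⟩
      simp only [ψ, LinearMap.comp_apply, h1, map_zero]
    let Φ : P →ₗ[B] (B ⧸ M) × S := ψ.prod (Submodule.projectionOnto _ _ hc1)
    have hΦ : Function.Surjective Φ := by
      rintro ⟨b, y⟩
      obtain ⟨b, rfl⟩ := Submodule.Quotient.mk_surjective _ b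
      refine ⟨g b + y, Prod.ext ?_ ?_⟩
      · simp [Φ, hψ, hψS y y.2]
      · have h1 : Submodule.projectionOnto _ _ hc1 (g b) = 0 :=
          Submodule.projectionOnto_apply_right hc1
            ⟨g b, Submodule.mem_sup_left (LinearMap.mem_range_self g b)⟩
        simp [Φ, h1]
    have hMΦ : M ≤ LinearMap.ker (Φ.comp f) := by
      intro a ha
      have h1 : f a = a • f 1 := by rw [← map_smul, smul_eq_mul, mul_one]
      rw [LinearMap.mem_ker, LinearMap.comp_apply, h1, map_smul]
      obtain ⟨b, hb⟩ := Submodule.Quotient.mk_surjective _ (Φ (f 1)).1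
      refine Prod.ext ?_ ?_
      · rw [Prod.smul_fst, ← hb, ← Submodule.Quotient.mk_smul]
        exact (Submodule.Quotient.mk_eq_zero _).2 (Ideal.mul_mem_right b M ha)
      · exact Module.mem_annihilator.1 ha _
    let Ψ : (B ⧸ M) →ₗ[B] (B ⧸ M) × S := Submodule.liftQ M (Φ.comp f) hMΦ
    have hΨ : Function.Surjective Ψ := fun x => by
      obtain ⟨b, hb⟩ := (hΦ.comp hf) x
      exact ⟨Submodule.Quotient.mk b, hb⟩
    -- A surjective endomorphism of the Noetherian module `B / M` is injective, which leaves no room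
    -- for `S`.
    have hinj : Function.Injective ((LinearMap.fst B (B ⧸ M) S).comp Ψ) :=
      IsNoetherian.injective_of_surjective_endomorphism _
        (Prod.fst_surjective.comp hΨ)
    refine hS.1 ((Submodule.eq_bot_iff _).2 fun y hy => ?_)
    obtain ⟨x, hx⟩ := hΨ (0, ⟨y, hy⟩)
    have hx0 : x = 0 := hinj (by simp [hx])
    rw [hx0, map_zero] at hx
    exact (congrArg Subtype.val (congrArg Prod.snd hx)).symm

/-- The version for left ideals: `L + B z` can be enlarged by an element of a left ideal. -/
theorem IsSemisimpleRing.exists_sup_span_lt {B : Type*} [Ring B] [IsSemisimpleRing B]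
    (L Y : Ideal B) (z : B) (hY : ¬ Y ≤ L ⊔ Ideal.span {z}) :
    ∃ y ∈ Y, L ⊔ Ideal.span {z} < L ⊔ Ideal.span {z + y} := by
  have key : ∀ x : B, L ⊔ Ideal.span {x} =
      (Submodule.span B {(Submodule.Quotient.mk x : B ⧸ L)}).comap L.mkQ := fun x => by
    have h1 : Submodule.span B {(Submodule.Quotient.mk x : B ⧸ L)} =
        Submodule.map L.mkQ (Submodule.span B {x}) := by
      rw [Submodule.map_span, Set.image_singleton]
      rfl
    rw [h1, Submodule.comap_map_mkQ]
  obtain ⟨y, hy, hlt⟩ := IsSemisimpleRing.exists_span_lt_span_add L.mkQ (Submodule.mkQ_surjective L)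
    (Submodule.Quotient.mk z) (Submodule.map L.mkQ Y) (fun h => hY (by
      rw [key, ← Submodule.map_le_iff_le_comap]
      exact h))
  obtain ⟨y, hyY, rfl⟩ := Submodule.mem_map.1 hy
  refine ⟨y, hyY, ?_⟩
  rw [key, key]
  exact Submodule.comap_strictMono_of_surjective (Submodule.mkQ_surjective L) hlt

/-- At a maximal ideal `t` of `K`, a finite `K`-algebra has a semisimple quotient that detects
whether left ideals are proper at `t`. -/
theorem exists_semisimple_residue {K : Type*} {A : Type v} [CommRing K] [Ring A] [Algebra K A]
    [Module.Finite K A] (t : Ideal K) [t.IsMaximal] :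
    ∃ (B : Type v) (_ : Ring B) (_ : IsSemisimpleRing B) (π : A →+* B),
      Function.Surjective π ∧ (∀ c ∈ t, π (algebraMap K A c) = 0) ∧
      ∀ X : Ideal A, X.map π = ⊤ → ∃ s ∉ t, algebraMap K A s ∈ X := by
  let I : Ideal A := t.map (algebraMap K A)
  have hI : I.IsTwoSided := ⟨fun {a} b ha => by
    refine Submodule.span_induction (p := fun x _ => x * b ∈ I) ?_ (by simp) ?_ ?_ ha
    · rintro _ ⟨c, hc, rfl⟩
      rw [Algebra.commutes]
      exact I.mul_mem_left b (Ideal.mem_map_of_mem _ hc)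
    · intro x y _ _ hx hy
      rw [add_mul]
      exact I.add_mem hx hy
    · intro r x _ hx
      rw [smul_eq_mul, mul_assoc]
      exact I.mul_mem_left r hx⟩
  let _ : Field (K ⧸ t) := Ideal.Quotient.field t
  let _ : Algebra (K ⧸ t) (A ⧸ I) := Ideal.Quotient.algebraQuotientOfLEComap Ideal.le_comap_map
  have : IsScalarTower K (K ⧸ t) (A ⧸ I) := IsScalarTower.of_algebraMap_eq fun _ => rfl
  have : Module.Finite (K ⧸ t) (A ⧸ I) := Module.Finite.of_restrictScalars_finite K _ _
  have : IsArtinianRing (A ⧸ I) := IsArtinianRing.of_finite (K ⧸ t) (A ⧸ I)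
  let q : A →+* A ⧸ I := Ideal.Quotient.mk I
  let p : A ⧸ I →+* (A ⧸ I) ⧸ Ring.jacobson (A ⧸ I) := Ideal.Quotient.mk _
  have hq : Function.Surjective q := Ideal.Quotient.mk_surjective
  have hp : Function.Surjective p := Ideal.Quotient.mk_surjective
  have hqt : ∀ c ∈ t, q (algebraMap K A c) = 0 := fun c hc =>
    Ideal.Quotient.eq_zero_iff_mem.2 (Ideal.mem_map_of_mem _ hc)
  refine ⟨_, inferInstance, inferInstance, p.comp q, hp.comp hq, fun c hc => ?_, fun X hX => ?_⟩
  · rw [RingHom.comp_apply, hqt c hc, map_zero]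
  -- A maximal left ideal contains the Jacobson radical, so properness is already visible modulo it.
  · have h1 : X.map q = ⊤ := by
      by_contra hne
      obtain ⟨m, hm, hXm⟩ := Ideal.exists_le_maximal _ hne
      obtain ⟨x, hx, hx1⟩ := (Ideal.mem_map_iff_of_surjective (p.comp q) (hp.comp hq)).1
        ((Ideal.eq_top_iff_one _).1 hX)
      have h2 : q x - 1 ∈ Ring.jacobson (A ⧸ I) := by
        rw [← Ideal.Quotient.eq_zero_iff_mem, map_sub, map_one, sub_eq_zero]
        exact hx1
      refine hm.ne_top ((Ideal.eq_top_iff_one _).2 ?_)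
      have := m.sub_mem (hXm (Ideal.mem_map_of_mem q hx)) (Ring.jacobson_le_of_isMaximal m h2)
      simpa using this
    obtain ⟨x, hx, hx1⟩ := (Ideal.mem_map_iff_of_surjective q hq).1
      ((Ideal.eq_top_iff_one _).1 h1)
    have h3 : ∀ a ∈ I, a ∈ t • (⊤ : Submodule K A) := by
      intro a ha
      refine Submodule.span_induction (p := fun x _ => x ∈ t • (⊤ : Submodule K A))
        ?_ (Submodule.zero_mem _) (fun x y _ _ hx hy => Submodule.add_mem _ hx hy) ?_ ha
      · rintro _ ⟨c, hc, rfl⟩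
        rw [Algebra.algebraMap_eq_smul_one]
        exact Submodule.smul_mem_smul hc trivial
      · intro r x _ hx
        have h4 := Submodule.mem_map_of_mem (f := LinearMap.mulLeft K r) hx
        rw [Submodule.map_smul''] at h4
        exact Submodule.smul_mono le_rfl le_top h4
    -- From `A = X + tA`, Nakayama for the finite `K`-module `A / X` gives a scalar congruent to `1`
    -- modulo `t` that kills `A / X`.
    have h5 : (⊤ : Submodule K (A ⧸ X)) ≤ t • (⊤ : Submodule K (A ⧸ X)) := by
      rintro y -
      obtain ⟨a, rfl⟩ := Submodule.Quotient.mk_surjective _ y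
      have h6 : a - a * x ∈ I := by
        rw [← Ideal.Quotient.eq_zero_iff_mem, map_sub, map_mul]
        change q a - q a * q x = 0
        rw [hx1, mul_one, sub_self]
      have h7 := Submodule.mem_map_of_mem (f := (X.mkQ).restrictScalars K) (h3 _ h6)
      rw [Submodule.map_smul''] at h7
      have h8 : (X.mkQ).restrictScalars K (a - a * x) = Submodule.Quotient.mk a := by
        rw [map_sub]
        exact sub_eq_self.2 ((Submodule.Quotient.mk_eq_zero _).2 (X.mul_mem_left a hx))
      rw [h8] at h7
      exact Submodule.smul_mono le_rfl le_top h7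
    have : Module.Finite K (A ⧸ X) :=
      Module.Finite.of_surjective ((X.mkQ).restrictScalars K) (Submodule.mkQ_surjective X)
    obtain ⟨r, hr, hr0⟩ := Submodule.exists_sub_one_mem_and_smul_eq_zero_of_fg_of_le_smul t ⊤
      Module.Finite.fg_top h5
    refine ⟨r, fun hrt => ?_, ?_⟩
    · exact (Ideal.IsMaximal.ne_top ‹_›) ((Ideal.eq_top_iff_one t).2
        (by simpa using t.sub_mem hrt hr))
    · have := hr0 (Submodule.Quotient.mk 1) trivial
      rwa [← Submodule.Quotient.mk_smul, ← Algebra.algebraMap_eq_smul_one,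
        Submodule.Quotient.mk_eq_zero] at this

/-! ### Bad loci and the ordinary stable range theorem. -/

/-- The set of maximal ideals of `K` at which a left ideal of a `K`-algebra is proper. -/
def badLocus (K : Type*) {A : Type*} [CommRing K] [Ring A] [Algebra K A] (X : Ideal A) :
    Set (MaximalSpectrum K) :=
  {t | ∀ s, algebraMap K A s ∈ X → s ∈ t.asIdeal}

section BadLocus

variable {K : Type*} {A : Type v} [CommRing K] [Ring A] [Algebra K A]

theorem badLocus_anti {X Y : Ideal A} (h : X ≤ Y) : badLocus K Y ⊆ badLocus K X :=
  fun _ ht s hs => ht s (h hs)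

theorem isClosed_badLocus (X : Ideal A) : IsClosed (badLocus K X) := by
  refine isClosed_induced_iff.2
    ⟨PrimeSpectrum.zeroLocus {s | algebraMap K A s ∈ X}, PrimeSpectrum.isClosed_zeroLocus _, ?_⟩
  ext t
  rfl

theorem eq_top_of_badLocus_eq_empty {X : Ideal A} (h : badLocus K X = ∅) : X = ⊤ := by
  by_contra hX
  have h1 : X.comap (algebraMap K A) ≠ ⊤ := fun h1 => hX <| (Ideal.eq_top_iff_one X).2 <| by
    simpa using (Ideal.eq_top_iff_one _).1 h1
  obtain ⟨t, ht, hXt⟩ := Ideal.exists_le_maximal _ h1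
  have : (⟨t, ht⟩ : MaximalSpectrum K) ∈ badLocus K X := fun s hs => hXt hs
  simp [h] at this

theorem smul_mem_of_algebraMap_mem {X : Ideal A} {s : K} (h : algebraMap K A s ∈ X) (a : A) :
    s • a ∈ X := by
  rw [Algebra.smul_def, Algebra.commutes]
  exact X.mul_mem_left a h

/-- Chinese remainders: `I` is comaximal with each point of `T`, hence with their intersection.
Multiples of `c` are changes invisible on `T` and complete modulo `I`. -/
theorem exists_mem_forall_one_sub_mem {T : Set (MaximalSpectrum K)} (hT : T.Finite) (I : Ideal K)
    (h : ∀ t ∈ T, ¬ I ≤ t.asIdeal) : ∃ c : K, (∀ t ∈ T, c ∈ t.asIdeal) ∧ 1 - c ∈ I := by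
  have h1 : I ⊔ ⨅ t ∈ hT.toFinset, t.asIdeal = ⊤ := Ideal.sup_iInf_eq_top fun t ht => by
    rw [sup_comm]
    exact Ideal.isMaximal_def.1 t.isMaximal |>.2 _ (left_lt_sup.2 (h t (by simpa using ht)))
  obtain ⟨a, ha, c, hc, hac⟩ := Submodule.mem_sup.1 ((Ideal.eq_top_iff_one _).1 h1)
  refine ⟨c, fun t ht => ?_, ?_⟩
  · simp only [Submodule.mem_iInf] at hc
    exact hc t (by simpa using ht)
  · rw [← hac]
    simpa using ha

theorem exists_sub_one_mem_forall_mem {T : Set (MaximalSpectrum K)} (hT : T.Finite)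
    {t : MaximalSpectrum K} (ht : t ∉ T) :
    ∃ c : K, (∀ s ∈ T, c ∈ s.asIdeal) ∧ 1 - c ∈ t.asIdeal :=
  exists_mem_forall_one_sub_mem hT _ fun s hs h => ht <| by
    have : t = s := MaximalSpectrum.ext (t.isMaximal.eq_of_le s.isMaximal.ne_top h)
    rwa [this]

theorem notMem_badLocus_iff {X : Ideal A} {t : MaximalSpectrum K} :
    t ∉ badLocus K X ↔ ∃ s ∉ t.asIdeal, algebraMap K A s ∈ X := by
  simp only [badLocus, Set.mem_ofPred_eq, not_forall]
  exact ⟨fun ⟨s, h1, h2⟩ => ⟨s, h2, h1⟩, fun ⟨s, h1, h2⟩ => ⟨s, h2, h1⟩⟩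

/-- A left ideal that is not proper at `t` generates the unit ideal in every quotient killed by
`t`. -/
theorem map_eq_top_of_notMem_badLocus {B : Type*} [Ring B] {π : A →+* B}
    {t : MaximalSpectrum K} (hπ : ∀ c ∈ t.asIdeal, π (algebraMap K A c) = 0) {X : Ideal A}
    (h : t ∉ badLocus K X) : X.map π = ⊤ := by
  obtain ⟨s, hs, hsX⟩ := notMem_badLocus_iff.1 h
  obtain ⟨u, v, hv, huv⟩ := t.isMaximal.exists_inv hs
  rw [Ideal.eq_top_iff_one, ← map_one π, ← map_one (algebraMap K A), ← huv, map_add, map_add,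
    hπ v hv, add_zero, map_mul]
  exact Ideal.mem_map_of_mem π (X.mul_mem_left _ hsX)

theorem sup_span_sup_le_of_mem (L : Ideal A) {Y : Ideal A} (z : A) {y : A} (hy : y ∈ Y) :
    L ⊔ Ideal.span {z} ⊔ Y ≤ L ⊔ Ideal.span {z + y} ⊔ Y := by
  refine sup_le (sup_le (le_sup_left.trans le_sup_left) ?_) le_sup_right
  have h := Ideal.sub_mem _ (Ideal.mem_sup_left (Ideal.mem_sup_right
    (Ideal.mem_span_singleton_self (z + y)) : z + y ∈ L ⊔ _)) (Ideal.mem_sup_right hy)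
  rwa [add_sub_cancel_right, ← Ideal.span_singleton_le_iff_mem] at h

theorem map_sup_span {B : Type*} [Ring B] (π : A →+* B) (L : Ideal A) (z : A) :
    (L ⊔ Ideal.span {z}).map π = L.map π ⊔ Ideal.span {π z} := by
  rw [Ideal.map_sup, Ideal.map_span, Set.image_singleton]

variable [Module.Finite K A]

/-- Stable rank one at finitely many maximal ideals. -/
theorem exists_forall_notMem_badLocus {T : Set (MaximalSpectrum K)} (hT : T.Finite)
    (L Y : Ideal A) (z : A) (h : L ⊔ Ideal.span {z} ⊔ Y = ⊤) :
    ∃ y ∈ Y, ∀ t ∈ T, t ∉ badLocus K (L ⊔ Ideal.span {z + y}) := by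
  choose B hB1 hB2 π hπ hπt hπX using
    fun t : MaximalSpectrum K => exists_semisimple_residue (A := A) t.asIdeal
  have key : ∀ t, ∃ y ∈ Y, (L ⊔ Ideal.span {z + y}).map (π t) = ⊤ := by
    intro t
    have hne : ((fun y => (L ⊔ Ideal.span {z + y}).map (π t)) '' (Y : Set A)).Nonempty :=
      ⟨_, 0, Y.zero_mem, rfl⟩
    -- If the maximal image did not contain the image of `Y`, the semisimple enlargement lemma would
    -- enlarge it.
    obtain ⟨_, ⟨y, hy, rfl⟩, hmax⟩ := set_has_maximal_iff_noetherian.2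
      (inferInstance : IsNoetherian (B t) (B t)) _ hne
    refine ⟨y, hy, ?_⟩
    dsimp only at hmax ⊢
    have hYle : Y.map (π t) ≤ (L ⊔ Ideal.span {z + y}).map (π t) := by
      rw [map_sup_span]
      by_contra hY
      obtain ⟨_, hu, hlt⟩ := IsSemisimpleRing.exists_sup_span_lt _ _ _ hY
      obtain ⟨u, huY, rfl⟩ := (Ideal.mem_map_iff_of_surjective _ (hπ t)).1 hu
      refine hmax _ ⟨y + u, Y.add_mem hy huY, rfl⟩ ?_
      change _ < Ideal.map (π t) (L ⊔ Ideal.span {z + (y + u)})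
      rwa [map_sup_span, map_sup_span, ← add_assoc, map_add _ (z + y) u]
    rw [eq_top_iff, ← Ideal.map_top (π t), ← h]
    refine (Ideal.map_mono (sup_span_sup_le_of_mem L z hy)).trans ?_
    rw [Ideal.map_sup]
    exact sup_le le_rfl hYle
  choose y hyY hy using key
  -- The local choices are glued by scalars `c t` equal to `1` at `t` and to `0` at the other points
  -- of `T`.
  choose c hc1 hc2 using fun t : MaximalSpectrum K =>
    exists_sub_one_mem_forall_mem (hT.subset (Set.sdiff_subset (t := {t})))
      (fun h => h.2 rfl : t ∉ T \ {t})
  refine ⟨∑ t ∈ hT.toFinset, c t • y t, Ideal.sum_mem _ fun t _ => ?_, fun t ht => ?_⟩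
  · rw [Algebra.smul_def]
    exact Y.mul_mem_left _ (hyY t)
  · have h1 : π t (∑ s ∈ hT.toFinset, c s • y s) = π t (y t) := by
      rw [map_sum, Finset.sum_eq_single t]
      · have := hπt t _ (hc2 t)
        rw [map_sub, map_sub, map_one, map_one, sub_eq_zero] at this
        rw [Algebra.smul_def, map_mul, ← this, one_mul]
      · intro s _ hst
        rw [Algebra.smul_def, map_mul, hπt t _ (hc1 s t ⟨ht, fun h => hst h.symm⟩), zero_mul]
      · intro h
        exact absurd (hT.mem_toFinset.2 ht) h
    have h2 := hy t
    rw [map_sup_span, map_add, ← h1, ← map_add, ← map_sup_span] at h2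
    exact notMem_badLocus_iff.2 (hπX t _ h2)

/-- **Stable range theorem** relative to a left ideal. The last element is replaced by a linear
map `w`, all of whose values may be used for the modification of the other elements. -/
theorem exists_sup_span_range_add_eq_top {N : Type*} [AddCommGroup N] [Module A N]
    (w : N →ₗ[A] A) (p : ℕ) (L : Ideal A) (hL : BassSerreSmall p (badLocus K L)) (z : Fin p → A)
    (h : L ⊔ Ideal.span (Set.range z) ⊔ LinearMap.range w = ⊤) :
    ∃ a : Fin p → N, L ⊔ Ideal.span (Set.range fun i => z i + w (a i)) = ⊤ := by
  induction p generalizing L with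
  | zero => exact ⟨Fin.elim0, by rw [eq_top_of_badLocus_eq_empty hL, top_sup_eq]⟩
  | succ p ih =>
    obtain ⟨T, hT, hTs⟩ := hL
    have hr : Set.range z = {z 0} ∪ Set.range (fun i : Fin p => z i.succ) := by
      rw [Set.singleton_union, ← Fin.range_cons]
      exact congrArg Set.range (Fin.cons_self_tail z).symm
    rw [hr, Ideal.span_union, ← sup_assoc, sup_assoc (L ⊔ _)] at h
    obtain ⟨y, hy, hyT⟩ := exists_forall_notMem_badLocus hT L _ (z 0) h
    obtain ⟨u, hu, v, ⟨b, rfl⟩, rfl⟩ := Submodule.mem_sup.1 hy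
    obtain ⟨r, rfl⟩ := (Submodule.mem_span_range_iff_exists_fun A).1 hu
    have h1 : L ⊔ Ideal.span {z 0 + (∑ i, r i • z i.succ + w b)} ⊔
        Ideal.span (Set.range fun i : Fin p => z i.succ) ⊔ LinearMap.range w = ⊤ := by
      rw [eq_top_iff, ← h, sup_assoc (L ⊔ _)]
      exact sup_span_sup_le_of_mem L (z 0) hy
    obtain ⟨a, ha⟩ := ih _ (hTs _ (isClosed_badLocus _) (badLocus_anti le_sup_left)
      (Set.disjoint_right.2 hyT)) _ h1
    -- The correction `- ∑ r i • a i` compensates for the change of the later entries: `z 0 + y` is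
    -- the new entry `0` plus `∑ r i * (z i.succ + w (a i))`.
    refine ⟨Fin.cons (b - ∑ i, r i • a i) a, ?_⟩
    rw [eq_top_iff, ← ha]
    have hs : ∀ i : Fin p, z i.succ + w (a i) ∈ L ⊔ Ideal.span (Set.range fun i : Fin (p + 1) =>
        z i + w ((Fin.cons (b - ∑ i, r i • a i) a : Fin (p + 1) → N) i)) := fun i =>
      Ideal.mem_sup_right (Ideal.subset_span ⟨i.succ, rfl⟩)
    refine sup_le (sup_le le_sup_left ?_) (Ideal.span_le.2 ?_)
    · rw [Ideal.span_singleton_le_iff_mem]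
      have h0 : z 0 + w (b - ∑ i, r i • a i) ∈ L ⊔ Ideal.span (Set.range fun i : Fin (p + 1) =>
          z i + w ((Fin.cons (b - ∑ i, r i • a i) a : Fin (p + 1) → N) i)) :=
        Ideal.mem_sup_right (Ideal.subset_span ⟨0, rfl⟩)
      convert Ideal.add_mem _ h0 (Ideal.sum_mem _ fun i (_ : i ∈ Finset.univ) =>
        Ideal.mul_mem_left _ (r i) (hs i)) using 1
      simp only [map_sub, map_sum, map_smul, smul_eq_mul, mul_add, Finset.sum_add_distrib]
      abel
    · rintro _ ⟨i, rfl⟩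
      exact hs i

end BadLocus

/-! ### Bimodules with involution and elementary moves. -/

/-- An involution `σ` on a left `A`-module `N` such that `(a, α) ↦ σ (α • σ a)` is a right
`A`-module structure making `N` a bimodule. -/
structure BimoduleInvolution (K : Type*) (A : Type*) (N : Type*) [CommRing K] [Ring A]
    [AddCommGroup N] [Module A N] [Module K N] where
  σ : N →ₗ[K] N
  σ_σ : ∀ a, σ (σ a) = a
  σ_smul_σ_smul : ∀ (α β : A) (a : N), σ (α • σ (β • a)) = β • σ (α • σ a)

namespace BimoduleInvolution

variable {K : Type*} {A : Type v} {N : Type*} [CommRing K] [Ring A]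
  [AddCommGroup N] [Module A N] [Module K N]
  (S : BimoduleInvolution K A N)

/-- The right multiplication by `α`. -/
def conj (α : A) : N →ₗ[A] N where
  toFun a := S.σ (α • S.σ a)
  map_add' a b := by simp only [map_add, smul_add]
  map_smul' β a := S.σ_smul_σ_smul α β a

theorem conj_apply (α : A) (a : N) : S.conj α a = S.σ (α • S.σ a) := rfl

theorem σ_smul_conj (α β : A) (a : N) : S.σ (α • S.conj β a) = β • S.conj α (S.σ a) := by
  rw [conj_apply, conj_apply, S.σ_σ, S.σ_smul_σ_smul, S.σ_σ]

theorem conj_algebraMap [Algebra K A] [IsScalarTower K A N] (c : K) (a : N) :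
    S.conj (algebraMap K A c) a = c • a := by
  rw [conj_apply, algebraMap_smul, map_smul, S.σ_σ]

theorem conj_sub (α β : A) (a : N) : S.conj (α - β) a = S.conj α a - S.conj β a := by
  simp only [conj_apply, sub_smul, map_sub]

theorem conj_zero (a : N) : S.conj 0 a = 0 := by simp [conj_apply]

theorem conj_one (a : N) : S.conj 1 a = a := by simp [conj_apply, S.σ_σ]

variable {ι : Type*}

/-- The left ideal generated by `L`, the sequence `z` and the values of the maps `w`. -/
def total (L : Ideal A) (z : ι → A) (w : ι → N →ₗ[A] A) : Ideal A :=
  L ⊔ Ideal.span (Set.range z) ⊔ ⨆ i, LinearMap.range (w i)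

theorem total_le {L X : Ideal A} {z : ι → A} {w : ι → N →ₗ[A] A} :
    total L z w ≤ X ↔ L ≤ X ∧ (∀ i, z i ∈ X) ∧ ∀ i b, w i b ∈ X := by
  rw [total, sup_le_iff, sup_le_iff, Ideal.span_le, iSup_le_iff, and_assoc]
  refine and_congr_right fun _ => and_congr ?_ (forall_congr' fun i => ?_)
  · exact Set.range_subset_iff
  · rw [LinearMap.range_le_iff_comap, Submodule.eq_top_iff']
    rfl

theorem le_total (L : Ideal A) (z : ι → A) (w : ι → N →ₗ[A] A) :
    L ≤ total L z w ∧ (∀ i, z i ∈ total L z w) ∧ ∀ i b, w i b ∈ total L z w :=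
  total_le.1 le_rfl

variable [Fintype ι]

/-- The sequence `z + (B - B^*) w`. -/
def perturb (z : ι → A) (w : ι → N →ₗ[A] A) (B : ι → ι → N) (l : ι) : A :=
  z l + ∑ m, w m (B l m - S.σ (B m l))

/-- The sequence `z` can be made unimodular modulo `L` by adding `(B - B^*) w`. -/
def IsReducible (L : Ideal A) (z : ι → A) (w : ι → N →ₗ[A] A) : Prop :=
  ∃ B : ι → ι → N, L ⊔ Ideal.span (Set.range (S.perturb z w B)) = ⊤

/-- Congruence preserves the shape `B - B^*`: with `C = h B h^*` the perturbed vector of `(z, w)` is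
`h` times that of `(z', w')`, and `g` recovers the latter. -/
theorem IsReducible.of_matrix [DecidableEq ι] {L : Ideal A} {z z' : ι → A} {w w' : ι → N →ₗ[A] A}
    {g h : Matrix ι ι A} (hgh : g * h = 1) (hz : ∀ l, z l = ∑ p, h l p * z' p)
    (hw : ∀ q b, w' q b = ∑ m, w m (S.conj (h m q) b)) (H : S.IsReducible L z' w') :
    S.IsReducible L z w := by
  obtain ⟨B, hB⟩ := H
  let C : ι → ι → N := fun l m => ∑ p, ∑ q, h l p • S.conj (h m q) (B p q)
  have hC : ∀ l m, C l m - S.σ (C m l) =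
      ∑ p, ∑ q, h l p • S.conj (h m q) (B p q - S.σ (B q p)) := by
    intro l m
    have : S.σ (C m l) = ∑ p, ∑ q, h l p • S.conj (h m q) (S.σ (B q p)) := by
      simp only [C, map_sum, S.σ_smul_conj]
      exact Finset.sum_comm
    rw [this]
    simp only [C, map_sub, smul_sub, Finset.sum_sub_distrib]
  have hrow : ∀ l, S.perturb z w C l = ∑ p, h l p * S.perturb z' w' B p := by
    intro l
    simp only [perturb, hC, mul_add, Finset.sum_add_distrib, ← hz, hw, map_sum, map_smul,
      smul_eq_mul, Finset.mul_sum]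
    congr 1
    rw [Finset.sum_comm]
    refine Finset.sum_congr rfl fun p _ => ?_
    rw [Finset.sum_comm]
  have hrow' : ∀ p, S.perturb z' w' B p = ∑ l, g p l * S.perturb z w C l := by
    intro p
    simp only [hrow, Finset.mul_sum, ← mul_assoc]
    rw [Finset.sum_comm]
    simp only [← Finset.sum_mul, ← Matrix.mul_apply, hgh]
    simp [Matrix.one_apply]
  refine ⟨C, ?_⟩
  rw [eq_top_iff, ← hB]
  refine sup_le_sup_left (Ideal.span_le.2 ?_) L
  rintro _ ⟨p, rfl⟩
  rw [hrow']
  exact Ideal.sum_mem _ fun l _ => Ideal.mul_mem_left _ _ (Ideal.subset_span ⟨l, rfl⟩)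

/-- Reducibility of `(z, w)` follows from that of `(z', w')`, and the left ideal generated by
`(z, w)` is contained in that of `(z', w')`. -/
def Reaches (L : Ideal A) (z : ι → A) (w : ι → N →ₗ[A] A) (z' : ι → A) (w' : ι → N →ₗ[A] A) :
    Prop :=
  (S.IsReducible L z' w' → S.IsReducible L z w) ∧ total L z w ≤ total L z' w'

variable {S} {L : Ideal A} {z z' z'' : ι → A} {w w' w'' : ι → N →ₗ[A] A}

theorem Reaches.refl (z : ι → A) (w : ι → N →ₗ[A] A) : S.Reaches L z w z w := ⟨id, le_rfl⟩

theorem Reaches.trans (h : S.Reaches L z w z' w') (h' : S.Reaches L z' w' z'' w'') :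
    S.Reaches L z w z'' w'' :=
  ⟨h.1 ∘ h'.1, h.2.trans h'.2⟩

/-- Base change by the elementary matrix `1 + α E_ij`; the dual variables `w` transform
contragrediently. -/
theorem reaches_transvection [DecidableEq ι] (z : ι → A) (w : ι → N →ₗ[A] A) {i j : ι}
    (hij : i ≠ j) (α : A) :
    S.Reaches L z w (Function.update z i (z i + α * z j))
      (Function.update w j (w j - (w i).comp (S.conj α))) := by
  refine ⟨IsReducible.of_matrix S (g := 1 + Matrix.single i j α)
    (h := 1 - Matrix.single i j α) ?_ ?_ ?_, ?_⟩
  · rw [mul_sub, mul_one, add_mul, one_mul, Matrix.single_mul_single_of_ne _ _ _ _ hij.symm]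
    simp
  · intro l
    simp only [Matrix.sub_apply, sub_mul, Finset.sum_sub_distrib, Matrix.one_apply, ite_mul,
      one_mul, zero_mul, Finset.sum_ite_eq, Finset.mem_univ, if_true]
    rcases eq_or_ne l i with rfl | hl
    · rw [Finset.sum_eq_single j]
      · simp [Function.update_of_ne hij.symm]
      · intro p _ hp
        rw [Matrix.single_apply_of_col_ne _ _ hp.symm, zero_mul]
      · simp
    · rw [Finset.sum_eq_zero]
      · simp [Function.update_of_ne hl]
      · intro p _
        rw [Matrix.single_apply_of_row_ne hl.symm, zero_mul]
  · intro q b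
    simp only [Matrix.sub_apply, S.conj_sub, map_sub, Finset.sum_sub_distrib]
    rw [Finset.sum_eq_single q]
    · rw [Matrix.one_apply_eq, S.conj_one]
      rcases eq_or_ne q j with rfl | hq
      · rw [Finset.sum_eq_single i]
        · simp
        · intro p _ hp
          rw [Matrix.single_apply_of_row_ne hp.symm, S.conj_zero, map_zero]
        · simp
      · rw [Finset.sum_eq_zero]
        · simp [Function.update_of_ne hq]
        · intro p _
          rw [Matrix.single_apply_of_col_ne _ _ hq.symm, S.conj_zero, map_zero]
    · intro p _ hp
      rw [Matrix.one_apply_ne hp, S.conj_zero, map_zero]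
    · simp
  · obtain ⟨h1, h2, h3⟩ := le_total L (Function.update z i (z i + α * z j))
      (Function.update w j (w j - (w i).comp (S.conj α)))
    refine total_le.2 ⟨h1, fun l => ?_, fun l b => ?_⟩
    · rcases eq_or_ne l i with rfl | hl
      · have := Ideal.sub_mem _ (h2 l) (Ideal.mul_mem_left _ α (h2 j))
        rwa [Function.update_self, Function.update_of_ne hij.symm, add_sub_cancel_right] at this
      · have := h2 l
        rwa [Function.update_of_ne hl] at this
    · rcases eq_or_ne l j with rfl | hl
      · have := Ideal.add_mem _ (h3 l b) (h3 i (S.conj α b))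
        rwa [Function.update_self, Function.update_of_ne hij, LinearMap.sub_apply,
          LinearMap.comp_apply, sub_add_cancel] at this
      · have := h3 l b
        rwa [Function.update_of_ne hl] at this

theorem reaches_of_sub_mem (w : ι → N →ₗ[A] A) (h : ∀ i, z i - z' i ∈ L) :
    S.Reaches L z w z' w := by
  constructor
  · rintro ⟨B, hB⟩
    refine ⟨B, ?_⟩
    rw [eq_top_iff, ← hB]
    refine sup_le le_sup_left (Ideal.span_le.2 ?_)
    rintro _ ⟨p, rfl⟩
    have h1 : S.perturb z w B p ∈ L ⊔ Ideal.span (Set.range (S.perturb z w B)) :=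
      Ideal.mem_sup_right (Ideal.subset_span ⟨p, rfl⟩)
    have h2 := Ideal.sub_mem _ h1 (Ideal.mem_sup_left (h p))
    have h3 : S.perturb z w B p - (z p - z' p) = S.perturb z' w B p := by
      simp only [perturb]
      abel
    exact h3 ▸ h2
  · obtain ⟨h1, h2, h3⟩ := le_total L z' w
    refine total_le.2 ⟨h1, fun l => ?_, h3⟩
    have := Ideal.add_mem _ (h1 (h l)) (h2 l)
    rwa [sub_add_cancel] at this

/-- The move adds `(B₀ - B₀^*) w`, where the only nonzero row of `B₀` is row `0`, equal to `(0, b)`;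
it is absorbed into the witness `B`. -/
theorem reaches_siegel {q : ℕ} (z : Fin (q + 1) → A) (w : Fin (q + 1) → N →ₗ[A] A)
    (b : Fin q → N) :
    S.Reaches L z w (Fin.cons (z 0 + ∑ i, w i.succ (b i))
      fun i => z i.succ - w 0 (S.σ (b i))) w := by
  constructor
  · rintro ⟨B, hB⟩
    refine ⟨fun l m => B l m + (Fin.cons (Fin.cons 0 b) (fun _ => 0) :
      Fin (q + 1) → Fin (q + 1) → N) l m, ?_⟩
    convert hB using 4
    refine funext fun l => ?_
    induction l using Fin.cases with
    | zero =>
      simp only [perturb, Fin.sum_univ_succ, Fin.cons_zero, Fin.cons_succ, map_add, map_sub,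
        map_zero, Pi.zero_apply, Finset.sum_add_distrib, Finset.sum_sub_distrib]
      simp
      abel
    | succ l =>
      simp only [perturb, Fin.sum_univ_succ, Fin.cons_zero, Fin.cons_succ, map_add, map_sub,
        map_zero, Pi.zero_apply, Finset.sum_add_distrib, Finset.sum_sub_distrib]
      simp
      abel
  · obtain ⟨h1, h2, h3⟩ := le_total L (Fin.cons (z 0 + ∑ i, w i.succ (b i))
      fun i => z i.succ - w 0 (S.σ (b i)) : Fin (q + 1) → A) w
    refine total_le.2 ⟨h1, fun l => ?_, h3⟩
    induction l using Fin.cases with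
    | zero =>
      have := Ideal.sub_mem _ (h2 0) (Ideal.sum_mem _ fun i (_ : i ∈ Finset.univ) =>
        h3 i.succ (b i))
      rwa [Fin.cons_zero, add_sub_cancel_right] at this
    | succ l =>
      have := Ideal.add_mem _ (h2 l.succ) (h3 0 (S.σ (b l)))
      rwa [Fin.cons_succ, sub_add_cancel] at this

end BimoduleInvolution

/-! ### Making the first entry unimodular at finitely many points. -/

/-- Properness at `t` is detected in a quotient killing `t`, where `x` and `x + c • y` coincide. -/
theorem notMem_badLocus_sup_span_add {K : Type*} {A : Type v} [CommRing K] [Ring A] [Algebra K A]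
    [Module.Finite K A] {L : Ideal A} {x : A} {t : MaximalSpectrum K}
    (h : t ∉ badLocus K (L ⊔ Ideal.span {x})) {c : K} (hc : c ∈ t.asIdeal) (y : A) :
    t ∉ badLocus K (L ⊔ Ideal.span {x + c • y}) := by
  obtain ⟨B, _, _, π, hπ, hπt, hπX⟩ := exists_semisimple_residue (A := A) t.asIdeal
  have h1 := map_eq_top_of_notMem_badLocus hπt h
  rw [notMem_badLocus_iff]
  apply hπX
  rwa [map_sup_span, map_add, Algebra.smul_def, map_mul, hπt c hc, zero_mul, add_zero,
    ← map_sup_span]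

namespace BimoduleInvolution

variable {K : Type*} {A : Type v} {N : Type*} [CommRing K] [Ring A] [Algebra K A]
  [Module.Finite K A] [AddCommGroup N] [Module A N] [Module K N] [IsScalarTower K A N]
  (S : BimoduleInvolution K A N)

/-- Only changes of `z 0` by multiples of `c` are used, with `c` zero on `T` and one at `t`, so `T`
is undisturbed. A state with maximal residue ideal `J` at `t` absorbs all other entries and all
values of `w`. The argument for `w 0` needs a second index, hence length `q + 2`. -/
theorem exists_reaches_insert {T : Set (MaximalSpectrum K)} (hT : T.Finite)
    {t : MaximalSpectrum K} (ht : t ∉ T) {L : Ideal A} {q : ℕ} (z : Fin (q + 2) → A)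
    (w : Fin (q + 2) → N →ₗ[A] A) (htot : total L z w = ⊤)
    (hz : ∀ s ∈ T, s ∉ badLocus K (L ⊔ Ideal.span {z 0})) :
    ∃ z' w', S.Reaches L z w z' w' ∧ t ∉ badLocus K (L ⊔ Ideal.span {z' 0}) ∧
      ∀ s ∈ T, s ∉ badLocus K (L ⊔ Ideal.span {z' 0}) := by
  obtain ⟨c, hcT, hct⟩ := exists_sub_one_mem_forall_mem hT ht
  obtain ⟨B, _, _, π, hπ, hπt, hπX⟩ := exists_semisimple_residue (A := A) t.asIdeal
  have hπc : π (algebraMap K A c) = 1 := by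
    have := hπt _ hct
    rw [map_sub, map_sub, map_one, map_one, sub_eq_zero] at this
    exact this.symm
  have hπs : ∀ a, π (c • a) = π a := fun a => by rw [Algebra.smul_def, map_mul, hπc, one_mul]
  let 𝒮 : Set ((Fin (q + 2) → A) × (Fin (q + 2) → N →ₗ[A] A)) :=
    {x | S.Reaches L z w x.1 x.2 ∧ ∀ s ∈ T, s ∉ badLocus K (L ⊔ Ideal.span {x.1 0})}
  let J : (Fin (q + 2) → A) × (Fin (q + 2) → N →ₗ[A] A) → Ideal B :=
    fun x => (L ⊔ Ideal.span {x.1 0}).map π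
  have hJ : ∀ x, J x = L.map π ⊔ Ideal.span {π (x.1 0)} := fun x => map_sup_span _ _ _
  obtain ⟨_, ⟨x, hx, rfl⟩, hmax⟩ := set_has_maximal_iff_noetherian.2
    (inferInstance : IsNoetherian B B) (J '' 𝒮) ⟨_, (z, w), ⟨Reaches.refl z w, hz⟩, rfl⟩
  -- a step whose effect on the first entry is a multiple of `c`
  have step : ∀ x ∈ 𝒮, ∀ z' w' a, S.Reaches L x.1 x.2 z' w' → z' 0 = x.1 0 + c • a →
      (z', w') ∈ 𝒮 := fun x hx z' w' a h ha => ⟨hx.1.trans h, fun s hs => by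
    dsimp only
    rw [ha]
    exact notMem_badLocus_sup_span_add (hx.2 s hs) (hcT s hs) a⟩
  -- enlarging `J x` by the elements of a left ideal `Y` realizable by steps is impossible
  have absorb : ∀ x' ∈ 𝒮, J x' = J x → ∀ Y : Ideal A,
      (∀ y ∈ Y, ∃ z' w', S.Reaches L x'.1 x'.2 z' w' ∧ z' 0 = x'.1 0 + c • y) →
      ∀ y ∈ Y, π y ∈ J x := by
    intro x' hx' hJx Y hY
    have : Y.map π ≤ J x := by
      by_contra hle
      rw [← hJx, hJ] at hle
      obtain ⟨_, hu, hlt⟩ := IsSemisimpleRing.exists_sup_span_lt _ _ _ hle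
      obtain ⟨u, huY, rfl⟩ := (Ideal.mem_map_iff_of_surjective _ hπ).1 hu
      obtain ⟨z', w', hr, h0⟩ := hY u huY
      refine hmax _ ⟨(z', w'), step _ hx' _ _ _ hr h0, rfl⟩ ?_
      rw [← hJx, hJ, hJ]
      dsimp only
      rw [h0, map_add, hπs]
      exact hlt
    exact fun y hy => this (Ideal.mem_map_of_mem π hy)
  have claim : ∀ x' ∈ 𝒮, J x' = J x → ∀ i : Fin (q + 1), π (x'.1 i.succ) ∈ J x ∧
      ∀ b, π (x'.2 i.succ b) ∈ J x := by
    refine fun x' hx' hJx i => ⟨?_, fun b => ?_⟩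
    · refine absorb x' hx' hJx (Ideal.span {x'.1 i.succ}) (fun y hy => ?_) _
        (Ideal.mem_span_singleton_self _)
      obtain ⟨α, rfl⟩ := Ideal.mem_span_singleton'.1 hy
      refine ⟨_, _, reaches_transvection x'.1 x'.2 (Fin.succ_ne_zero i).symm (c • α), ?_⟩
      rw [Function.update_self, smul_mul_assoc]
    · refine absorb x' hx' hJx (LinearMap.range (x'.2 i.succ)) (fun y hy => ?_) _ ⟨b, rfl⟩
      obtain ⟨a, rfl⟩ := hy
      refine ⟨_, _, reaches_siegel x'.1 x'.2 (Pi.single i (c • a)), ?_⟩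
      rw [Fin.cons_zero, Finset.sum_eq_single i]
      · rw [Pi.single_eq_same, ← algebraMap_smul A c a, map_smul, algebraMap_smul]
      · intro j _ hj
        rw [Pi.single_eq_of_ne hj, map_zero]
      · simp
  have hz0 : π (x.1 0) ∈ J x := by
    rw [hJ]
    exact Ideal.mem_sup_right (Ideal.mem_span_singleton_self _)
  -- No move adds values of `w 0` to `z 0` directly, so `w 0` is first transferred into `w 1`.
  have hw0 : ∀ b, π (x.2 0 b) ∈ J x := by
    intro b
    obtain ⟨u, hu, hπu⟩ := (Ideal.mem_map_iff_of_surjective _ hπ).1 (claim x hx rfl 0).1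
    obtain ⟨l, hl, v, hv, rfl⟩ := Submodule.mem_sup.1 hu
    obtain ⟨β, rfl⟩ := Ideal.mem_span_singleton'.1 hv
    have h10 : (Fin.succ 0 : Fin (q + 2)) ≠ 0 := Fin.succ_ne_zero 0
    obtain ⟨z1, w1, hr1, hz1, hπ1, hw1, hw1'⟩ : ∃ z1 w1, S.Reaches L x.1 x.2 z1 w1 ∧
        z1 0 = x.1 0 ∧ π (z1 (Fin.succ 0)) = 0 ∧
        w1 0 = x.2 0 - (x.2 (Fin.succ 0)).comp (S.conj (-β)) ∧
        w1 (Fin.succ 0) = x.2 (Fin.succ 0) := by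
      -- Since `z 1` has residue in `J`, subtracting `β * z 0` and `l ∈ L` makes its residue vanish
      -- while `z 0` stays fixed.
      refine ⟨Function.update x.1 (Fin.succ 0) (x.1 (Fin.succ 0) + (-β) * x.1 0 - l), _,
        (reaches_transvection x.1 x.2 h10 (-β)).trans (reaches_of_sub_mem _ fun i => ?_),
        ?_, ?_, ?_, ?_⟩
      · rcases eq_or_ne i (Fin.succ 0) with rfl | hi
        · simpa using hl
        · rw [Function.update_of_ne hi, Function.update_of_ne hi, sub_self]
          exact L.zero_mem
      · rw [Function.update_of_ne h10.symm]
      · rw [Function.update_self, map_sub, map_add, ← hπu, ← map_add, ← map_sub]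
        convert map_zero π using 2
        noncomm_ring
      · rw [Function.update_self]
      · rw [Function.update_of_ne h10]
    -- This replaces `w 1` by `w 1 + c w 0`, with the current `w 0`. It changes `z 0` by a multiple
    -- of `z 1`, which has zero residue, so `J` is unchanged and `claim` applies to the new state.
    have hr2 := reaches_transvection (S := S) (L := L) z1 w1 h10.symm (c • (-1))
    have hx2 := step x hx _ _ (-z1 (Fin.succ 0)) (hr1.trans hr2) (by
      rw [Function.update_self, hz1, smul_mul_assoc, neg_one_mul])
    have h2 := (claim _ hx2 (by
      rw [hJ, hJ]
      dsimp only
      rw [Function.update_self, hz1, smul_mul_assoc, map_add, hπs, neg_one_mul, map_neg, hπ1,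
        neg_zero, add_zero]) 0).2 b
    dsimp only at h2
    have h3 : S.conj (c • (-1)) b = -(c • b) := by
      rw [smul_neg, ← Algebra.algebraMap_eq_smul_one, ← map_neg, S.conj_algebraMap, neg_smul]
    rw [Function.update_self, LinearMap.sub_apply, LinearMap.comp_apply, h3, hw1', hw1, map_neg,
      sub_neg_eq_add, map_add] at h2
    have h4 := Ideal.sub_mem _ h2 ((claim x hx rfl 0).2 b)
    rw [add_sub_cancel_left, ← algebraMap_smul A c b, map_smul, algebraMap_smul, hπs,
      LinearMap.sub_apply, LinearMap.comp_apply, map_sub] at h4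
    have h5 := Ideal.add_mem _ h4 ((claim x hx rfl 0).2 (S.conj (-β) b))
    rwa [sub_add_cancel] at h5
  refine ⟨x.1, x.2, hx.1, notMem_badLocus_iff.2 (hπX _ ?_), hx.2⟩
  have htop : total L x.1 x.2 ≤ (J x).comap π := by
    refine total_le.2 ⟨fun l hl => Ideal.mem_map_of_mem π (Ideal.mem_sup_left hl),
      fun i => ?_, fun i b => ?_⟩
    · induction i using Fin.cases with
      | zero => exact hz0
      | succ i => exact (claim x hx rfl i).1
    · induction i using Fin.cases with
      | zero => exact hw0 b
      | succ i => exact (claim x hx rfl i).2 b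
  have htot' := hx.1.2
  rw [htot, top_le_iff] at htot'
  rw [htot'] at htop
  rw [Ideal.eq_top_iff_one, ← map_one π]
  exact htop trivial

theorem exists_reaches_forall_notMem_badLocus {T : Set (MaximalSpectrum K)} (hT : T.Finite)
    {L : Ideal A} {q : ℕ} (z : Fin (q + 2) → A)
    (w : Fin (q + 2) → N →ₗ[A] A) (htot : total L z w = ⊤) :
    ∃ z' w', S.Reaches L z w z' w' ∧ ∀ s ∈ T, s ∉ badLocus K (L ⊔ Ideal.span {z' 0}) := by
  induction T, hT using Set.Finite.induction_on with
  | empty => exact ⟨z, w, Reaches.refl z w, fun s hs => hs.elim⟩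
  | @insert t T ht hT ih =>
    obtain ⟨z1, w1, hr, h⟩ := ih
    obtain ⟨z2, w2, hr2, h2, h3⟩ := S.exists_reaches_insert hT ht z1 w1
      (top_unique (htot ▸ hr.2)) h
    refine ⟨z2, w2, hr.trans hr2, fun s hs => ?_⟩
    rcases hs with rfl | hs
    exacts [h2, h3 s hs]

end BimoduleInvolution

/-! ### Induction on the height of the bad locus. -/

namespace BimoduleInvolution

variable {K : Type*} {A : Type v} {N : Type*} [CommRing K] [Ring A] [Algebra K A]
  [Module.Finite K A] [AddCommGroup N] [Module A N] [Module K N] [IsScalarTower K A N]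
  (S : BimoduleInvolution K A N)

/-- The relative form of the main theorem for algebras that are finite over `K`. -/
theorem isReducible_of_bassSerreSmall (q : ℕ) (L : Ideal A)
    (hL : BassSerreSmall q (badLocus K L)) (z : Fin (q + 1) → A) (w : Fin (q + 1) → N →ₗ[A] A)
    (htot : total L z w = ⊤) : S.IsReducible L z w := by
  induction q generalizing L with
  | zero => exact ⟨0, by rw [eq_top_of_badLocus_eq_empty hL, top_sup_eq]⟩
  | succ q ih =>
    obtain ⟨T, hT, hTs⟩ := id hL
    obtain ⟨z1, w1, hr1, hz1⟩ := S.exists_reaches_forall_notMem_badLocus hT z w htot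
    have htot1 : total L z1 w1 = ⊤ := top_unique (htot ▸ hr1.2)
    -- Because `1 - c` lies in `L + A z_0`, the values of `w 0` and of `c • w 0` agree modulo this
    -- left ideal, so `c • w 0` may replace `w 0` in the stable range theorem.
    obtain ⟨c, hcT, hc⟩ := exists_mem_forall_one_sub_mem hT
      ((L ⊔ Ideal.span {z1 0}).comap (algebraMap K A)) fun t ht hle => hz1 t ht fun s hs => hle hs
    let X : Ideal A := L ⊔ Ideal.span {z1 0} ⊔ ⨆ i : Fin (q + 1), LinearMap.range (w1 i.succ)
    have hLX : L ≤ X := le_sup_left.trans le_sup_left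
    have hwX : ∀ i b, w1 (Fin.succ i) b ∈ X := fun i b =>
      Ideal.mem_sup_right (Submodule.mem_iSup_of_mem i ⟨b, rfl⟩)
    obtain ⟨a, ha⟩ := exists_sup_span_range_add_eq_top (c • w1 0) (q + 1) X
      (hL.mono (badLocus_anti hLX)) (fun i => z1 i.succ) (by
        rw [eq_top_iff, ← htot1]
        refine total_le.2 ⟨hLX.trans (le_sup_left.trans le_sup_left), fun i => ?_, fun i b => ?_⟩
        · induction i using Fin.cases with
          | zero => exact Ideal.mem_sup_left (Ideal.mem_sup_left (Ideal.mem_sup_left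
              (Ideal.mem_sup_right (Ideal.mem_span_singleton_self _))))
          | succ i => exact Ideal.mem_sup_left (Ideal.mem_sup_right (Ideal.subset_span ⟨i, rfl⟩))
        · induction i using Fin.cases with
          | zero =>
            rw [← one_smul K (w1 0 b), ← add_sub_cancel c 1, add_smul]
            refine Ideal.add_mem _ (Ideal.mem_sup_right ⟨b, rfl⟩) (Ideal.mem_sup_left
              (Ideal.mem_sup_left (Ideal.mem_sup_left (smul_mem_of_algebraMap_mem hc _))))
          | succ i => exact Ideal.mem_sup_left (Ideal.mem_sup_left (hwX i b)))
    -- Chosen so that the Siegel move adds `c • w 0 (a i)` to the later entries; its side effect on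
    -- entry `0` is then a multiple of `c`, harmless on `T`.
    let b : Fin (q + 1) → N := fun i => -S.σ (c • a i)
    have hr2 := reaches_siegel (S := S) (L := L) z1 w1 b
    have hb0 : ∑ i, w1 i.succ (b i) = c • ∑ i, w1 i.succ (-S.σ (a i)) := by
      rw [Finset.smul_sum]
      refine Finset.sum_congr rfl fun i _ => ?_
      simp only [b]
      rw [map_smul, ← smul_neg, ← algebraMap_smul A c, map_smul, algebraMap_smul]
    have hbs : ∀ i, z1 i.succ - w1 0 (S.σ (b i)) = z1 i.succ + (c • w1 0) (a i) := fun i => by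
      simp only [b]
      rw [map_neg, S.σ_σ, map_neg, sub_neg_eq_add, ← algebraMap_smul A c, map_smul,
        algebraMap_smul, LinearMap.smul_apply]
    let z0 : A := z1 0 + ∑ i, w1 i.succ (b i)
    let zs : Fin (q + 1) → A := fun i => z1 i.succ - w1 0 (S.σ (b i))
    change S.Reaches L z1 w1 (Fin.cons z0 zs) w1 at hr2
    have hsmall : BassSerreSmall q (badLocus K (L ⊔ Ideal.span {z0})) := by
      refine hTs _ (isClosed_badLocus _) (badLocus_anti le_sup_left)
        (Set.disjoint_right.2 fun t ht => ?_)
      simp only [z0, hb0]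
      exact notMem_badLocus_sup_span_add (hz1 t ht) (hcT t ht) _
    obtain ⟨B, hB⟩ := ih _ hsmall zs (fun i => w1 i.succ) (by
      obtain ⟨h1, h2, h3⟩ := le_total (L ⊔ Ideal.span {z0}) zs fun i => w1 i.succ
      have hL1 := le_sup_left.trans h1
      rw [eq_top_iff, ← ha]
      refine sup_le (sup_le (sup_le hL1 ?_) (iSup_le fun i => ?_)) (Ideal.span_le.2 ?_)
      · rw [Ideal.span_singleton_le_iff_mem]
        have := Ideal.sub_mem _ (h1 (Ideal.mem_sup_right (Ideal.mem_span_singleton_self z0)))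
          (Ideal.sum_mem _ fun i (_ : i ∈ Finset.univ) => h3 i (b i))
        rwa [add_sub_cancel_right] at this
      · rintro _ ⟨y, rfl⟩
        exact h3 i y
      · rintro _ ⟨i, rfl⟩
        have := h2 i
        change z1 i.succ - w1 0 (S.σ (b i)) ∈ _ at this
        rwa [hbs] at this)
    -- Padding by a zero row and column leaves entry `0` alone, so its span plays the part it had in
    -- the auxiliary ideal.
    refine (hr1.trans hr2).1 ⟨Fin.cons 0 fun l => Fin.cons 0 (B l), ?_⟩
    rw [eq_top_iff, ← hB]
    refine sup_le (sup_le le_sup_left ?_) (Ideal.span_le.2 ?_)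
    · rw [Ideal.span_singleton_le_iff_mem]
      refine Ideal.mem_sup_right (Ideal.subset_span ⟨0, ?_⟩)
      simp [perturb, Fin.sum_univ_succ]
    · rintro _ ⟨i, rfl⟩
      refine Ideal.mem_sup_right (Ideal.subset_span ⟨i.succ, ?_⟩)
      simp [perturb, Fin.sum_univ_succ]

end BimoduleInvolution

/-! ### Finite involution subalgebras of quasi-finite algebras. -/

section QuasiFinite

variable {K : Type*} {R : Type*} [CommRing K] [StarRing K] [TrivialStar K] [NonUnitalRing R]
  [StarRing R] [Module K R] [IsScalarTower K R R] [SMulCommClass K R R] [StarModule K R]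

/-- A finite subset of a finite subalgebra that also contains the conjugates of its elements lies
in a finite involution subalgebra. -/
theorem exists_finite_nonUnitalStarSubalgebra (M : Submodule K R) (hM : M.FG)
    (hmul : ∀ x ∈ M, ∀ y ∈ M, x * y ∈ M) (s : Set R) (hs : s.Finite) (hsM : s ⊆ M)
    (hsM' : ∀ x ∈ s, star x ∈ M) :
    ∃ R₀ : NonUnitalStarSubalgebra K R, s ⊆ R₀ ∧ Module.Finite K R₀ := by
  obtain ⟨n, b, rfl⟩ := Submodule.fg_iff_exists_fin_generating_family.1 hM
  have hb : ∀ p, b p ∈ Submodule.span K (Set.range b) := fun p => Submodule.subset_span ⟨p, rfl⟩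
  choose! f hf using fun x (hx : x ∈ Submodule.span K (Set.range b)) =>
    (Submodule.mem_span_range_iff_exists_fun K).1 hx
  let U : Set R := s ∪ star '' s ∪ Set.range fun p : Fin n × Fin n => b p.1 * b p.2
  have hU : U.Finite := (hs.union (hs.image _)).union (Set.finite_range _)
  have hUM : ∀ x ∈ U, x ∈ Submodule.span K (Set.range b) := by
    rintro x ((hx | ⟨y, hy, rfl⟩) | ⟨p, rfl⟩)
    exacts [hsM hx, hsM' y hy, hmul _ (hb _) _ (hb _)]
  -- The coefficients expressing `s`, `star s` and the products of generators generate a Noetherian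
  -- subring `K₀`, over which a multiplicatively closed lattice `B₀` is already defined.
  let C : Set K := ⋃ x ∈ U, Set.range (f x)
  have hC : C.Finite := hU.biUnion fun x _ => Set.finite_range _
  let K₀ : Subring K := Subring.closure C
  have : IsNoetherianRing K₀ := is_noetherian_subring_closure C hC
  let B₀ : Submodule K₀ R := Submodule.span K₀ (Set.range b)
  have hUB : ∀ x ∈ U, x ∈ B₀ := fun x hx => by
    rw [← hf x (hUM x hx)]
    refine Submodule.sum_mem _ fun i _ => ?_
    have hi : f x i ∈ K₀ := Subring.subset_closure (Set.mem_biUnion hx ⟨i, rfl⟩)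
    exact B₀.smul_mem ⟨_, hi⟩ (Submodule.subset_span ⟨i, rfl⟩)
  have hB₀mul : ∀ x ∈ B₀, ∀ y ∈ B₀, x * y ∈ B₀ := by
    intro x hx y hy
    induction hx, hy using Submodule.span_induction₂ with
    | mem_mem x y hx hy =>
      obtain ⟨p, rfl⟩ := hx
      obtain ⟨q, rfl⟩ := hy
      exact hUB _ (Or.inr ⟨(p, q), rfl⟩)
    | zero_left => simp
    | zero_right => simp
    | add_left x y z _ _ _ hx hy => rw [add_mul]; exact B₀.add_mem hx hy
    | add_right x y z _ _ _ hx hy => rw [mul_add]; exact B₀.add_mem hx hy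
    | smul_left r x y _ _ h => rw [smul_mul_assoc]; exact B₀.smul_mem r h
    | smul_right r x y _ _ h => rw [mul_smul_comm]; exact B₀.smul_mem r h
  have hstar : ∀ (k : K) (x : R), star (k • x) = k • star x := fun k x => by
    rw [star_smul, star_trivial]
  -- `B₀` need not be stable under the involution. Its intersection with its conjugate is, and
  -- remains finitely generated because `K₀` is Noetherian.
  let B₁ : Submodule K₀ R :=
    { carrier := {x | x ∈ B₀ ∧ star x ∈ B₀}
      add_mem' := fun hx hy => ⟨B₀.add_mem hx.1 hy.1, by
        rw [star_add]; exact B₀.add_mem hx.2 hy.2⟩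
      zero_mem' := ⟨B₀.zero_mem, by rw [star_zero]; exact B₀.zero_mem⟩
      smul_mem' := fun k x hx => ⟨B₀.smul_mem k hx.1, by
        have := B₀.smul_mem k hx.2
        rwa [Subring.smul_def, ← hstar] at this⟩ }
  have hB₁ : B₁.FG := by
    have : IsNoetherian K₀ B₀ :=
      isNoetherian_of_fg_of_noetherian _ (Submodule.fg_span (Set.finite_range b))
    exact isNoetherian_submodule.1 this B₁ fun x hx => hx.1
  let R₀ : NonUnitalStarSubalgebra K R :=
    { Submodule.span K (B₁ : Set R) with
      mul_mem' := by
        intro x y hx hy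
        induction hx, hy using Submodule.span_induction₂ with
        | mem_mem x y hx hy =>
          exact Submodule.subset_span ⟨hB₀mul x hx.1 y hy.1, by
            rw [star_mul]; exact hB₀mul _ hy.2 _ hx.2⟩
        | zero_left => simp
        | zero_right => simp
        | add_left x y z _ _ _ hx hy => rw [add_mul]; exact Submodule.add_mem _ hx hy
        | add_right x y z _ _ _ hx hy => rw [mul_add]; exact Submodule.add_mem _ hx hy
        | smul_left r x y _ _ h => rw [smul_mul_assoc]; exact Submodule.smul_mem _ r h
        | smul_right r x y _ _ h => rw [mul_smul_comm]; exact Submodule.smul_mem _ r h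
      star_mem' := by
        intro x hx
        induction hx using Submodule.span_induction with
        | mem x hx => exact Submodule.subset_span ⟨hx.2, by rw [star_star]; exact hx.1⟩
        | zero => simp
        | add x y _ _ hx hy => rw [star_add]; exact Submodule.add_mem _ hx hy
        | smul r x _ h => rw [hstar]; exact Submodule.smul_mem _ r h }
  refine ⟨R₀, fun x hx => Submodule.subset_span ⟨hUB x (Or.inl (Or.inl hx)),
    hUB _ (Or.inl (Or.inr ⟨x, hx, rfl⟩))⟩, ?_⟩
  have hfg : (Submodule.span K (B₁ : Set R)).FG := by
    obtain ⟨G, hG⟩ := hB₁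
    refine ⟨G, le_antisymm (Submodule.span_mono fun x hx => ?_) (Submodule.span_le.2 ?_)⟩
    · rw [← hG]
      exact Submodule.subset_span hx
    · rw [← hG]
      have : Submodule.span K₀ (G : Set R) ≤ (Submodule.span K (G : Set R)).restrictScalars K₀ :=
        Submodule.span_le.2 Submodule.subset_span
      exact this
  exact Module.Finite.iff_fg.2 hfg

theorem IsQuasiFiniteAlgebra.exists_finite_nonUnitalStarSubalgebra
    (h : IsQuasiFiniteAlgebra K R) (s : Set R) (hs : s.Finite) :
    ∃ R₀ : NonUnitalStarSubalgebra K R, s ⊆ R₀ ∧ Module.Finite K R₀ := by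
  obtain ⟨F⟩ := h
  let _ := F.preorder
  have := F.nonempty
  let _ := F.ring
  let _ := F.module
  have := F.finite
  have key : ∀ t : Set R, t.Finite → ∃ i, ∀ r ∈ t, ∃ x : F.A i, F.toLimit i x = r := by
    intro t ht
    induction t, ht using Set.Finite.induction_on with
    | empty => exact ⟨Classical.arbitrary _, fun r hr => hr.elim⟩
    | @insert a t _ _ ih =>
      obtain ⟨i, hi⟩ := ih
      obtain ⟨j, y, hy⟩ := F.exists_toLimit a
      obtain ⟨k, hik, hjk⟩ := F.directed i j
      refine ⟨k, fun r hr => ?_⟩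
      rcases hr with rfl | hr
      · exact ⟨F.map hjk y, by rw [F.toLimit_map, hy]⟩
      · obtain ⟨x, hx⟩ := hi r hr
        exact ⟨F.map hik x, by rw [F.toLimit_map, hx]⟩
  obtain ⟨i, hi⟩ := key (s ∪ star '' s) (hs.union (hs.image _))
  let φ : F.A i →ₗ[K] R := (F.toLimit i : F.A i →ₗ[K] R)
  refine _root_.exists_finite_nonUnitalStarSubalgebra (LinearMap.range φ)
    (Submodule.fg_range φ) ?_ s hs (fun x hx => hi x (Or.inl hx))
    (fun x hx => hi _ (Or.inr ⟨x, hx, rfl⟩))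
  rintro _ ⟨x, rfl⟩ _ ⟨y, rfl⟩
  exact ⟨x * y, map_mul (F.toLimit i) x y⟩

end QuasiFinite

/-! ### Corner rings and Peirce components over finite algebras. -/

section Corner

variable {K : Type*} {R : Type v} [CommRing K] [NonUnitalRing R] [Module K R]
  [IsScalarTower K R R] [SMulCommClass K R R]

theorem mem_peirceBlock_iff {e f x : R} (he : e * e = e) (hf : f * f = f) :
    x ∈ peirceBlock e f ↔ e * x = x ∧ x * f = x := by
  constructor
  · rintro ⟨r, rfl⟩
    exact ⟨by rw [← mul_assoc, ← mul_assoc, he], by rw [mul_assoc, hf]⟩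
  · rintro ⟨h1, h2⟩
    exact ⟨x, by rw [h1, h2]⟩

variable {e : R} (he : IsIdempotentElem e)

/-- An element of `e R e` as an element of the corner ring. -/
def toCorner (x : R) (hx : x ∈ peirceBlock e e) : he.Corner :=
  ⟨x, (Subsemigroup.mem_corner_iff he).2 ((mem_peirceBlock_iff he he).1 hx)⟩

theorem corner_mem (x : he.Corner) : e * x.1 = x.1 ∧ x.1 * e = x.1 :=
  (Subsemigroup.mem_corner_iff he).1 x.2

/-- The inclusion of the corner ring. -/
def cornerVal : he.Corner →+ R where
  toFun := Subtype.val
  map_zero' := rfl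
  map_add' _ _ := rfl

theorem cornerVal_injective : Function.Injective (cornerVal he) := Subtype.val_injective

instance cornerSMul : SMul K he.Corner :=
  ⟨fun k x => ⟨k • x.1, (Subsemigroup.mem_corner_iff he).2
    ⟨by rw [mul_smul_comm, (corner_mem he x).1], by rw [smul_mul_assoc, (corner_mem he x).2]⟩⟩⟩

instance cornerModule : Module K he.Corner :=
  Function.Injective.module K (cornerVal he) (cornerVal_injective he) fun _ _ => rfl

instance cornerAlgebra : Algebra K he.Corner :=
  Algebra.ofModule (fun k x y => Subtype.ext (smul_mul_assoc k x.1 y.1))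
    (fun k x y => Subtype.ext (mul_smul_comm k x.1 y.1))

instance cornerFinite [Module.Finite K R] : Module.Finite K he.Corner :=
  Module.Finite.of_surjective
    ({ toFun := fun r => ⟨e * r * e, r, rfl⟩
       map_add' := fun x y => Subtype.ext (by
        change e * (x + y) * e = e * x * e + e * y * e
        rw [mul_add, add_mul])
       map_smul' := fun k x => Subtype.ext (by
        change e * (k • x) * e = k • (e * x * e)
        rw [mul_smul_comm, smul_mul_assoc]) } : R →ₗ[K] he.Corner)
    fun x => ⟨x.1, Subtype.ext (by
      change e * x.1 * e = x.1
      rw [(corner_mem he x).1, (corner_mem he x).2])⟩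

theorem isRightUnimodular_iff {k : ℕ} (z : Fin k → he.Corner) :
    IsRightUnimodular e (fun i => cornerVal he (z i)) ↔ Ideal.span (Set.range z) = ⊤ := by
  rw [Ideal.eq_top_iff_one]
  refine Iff.trans ?_ (Submodule.mem_span_range_iff_exists_fun he.Corner).symm
  constructor
  · rintro ⟨y, hy, h⟩
    refine ⟨fun i => toCorner he (y i) (hy i), cornerVal_injective he ?_⟩
    rw [map_sum]
    exact h
  · rintro ⟨y, h⟩
    refine ⟨fun i => cornerVal he (y i), fun i => (mem_peirceBlock_iff he he).2 (corner_mem he _),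
      ?_⟩
    have := congrArg (cornerVal he) h
    rw [map_sum] at this
    exact this

theorem stableRankLE_of_finite (he : IsIdempotentElem e) [Module.Finite K R] {m : ℕ}
    (hK : BassSerreSmall m (Set.univ : Set (MaximalSpectrum K))) : StableRankLE e m := by
  intro x hx hu
  let z : Fin (m + 1) → he.Corner := fun i => toCorner he (x i) (hx i)
  have hz : Ideal.span (Set.range z) = ⊤ := (isRightUnimodular_iff he z).1 hu
  -- The ordinary stable rank is the case `N = A`, `L = ⊥`, with `w` right multiplication by the
  -- last entry.
  obtain ⟨a, ha⟩ := exists_sup_span_range_add_eq_top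
    (LinearMap.toSpanSingleton he.Corner he.Corner (z (Fin.last m))) m ⊥
    (hK.mono (Set.subset_univ _)) (fun i => z i.castSucc) (by
      rw [eq_top_iff, ← hz, Ideal.span_le]
      rintro _ ⟨i, rfl⟩
      induction i using Fin.lastCases with
      | last => exact Ideal.mem_sup_right ⟨1, one_smul _ _⟩
      | cast i => exact Ideal.mem_sup_left (Ideal.mem_sup_right (Ideal.subset_span ⟨i, rfl⟩)))
  rw [bot_sup_eq] at ha
  exact ⟨fun i => cornerVal he (a i), fun i => (mem_peirceBlock_iff he he).2 (corner_mem he _),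
    (isRightUnimodular_iff he _).2 ha⟩

/-- The Peirce component `e R f` as a submodule. -/
def peirceSubmodule (K : Type*) {R : Type*} [CommRing K] [NonUnitalRing R] [Module K R]
    [IsScalarTower K R R] [SMulCommClass K R R] (e f : R) : Submodule K R where
  carrier := {x | e * x = x ∧ x * f = x}
  zero_mem' := ⟨mul_zero _, zero_mul _⟩
  add_mem' := fun ⟨h1, h2⟩ ⟨h3, h4⟩ => ⟨by rw [mul_add, h1, h3], by rw [add_mul, h2, h4]⟩
  smul_mem' := fun k x ⟨h1, h2⟩ => ⟨by rw [mul_smul_comm, h1], by rw [smul_mul_assoc, h2]⟩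

instance peirceModule (f : R) : Module he.Corner (peirceSubmodule K e f) where
  smul α x := ⟨α.1 * x.1, by rw [← mul_assoc, (corner_mem he α).1],
    by rw [mul_assoc, x.2.2]⟩
  one_smul x := Subtype.ext x.2.1
  mul_smul α β x := Subtype.ext (mul_assoc α.1 β.1 x.1)
  smul_zero α := Subtype.ext (mul_zero α.1)
  smul_add α x y := Subtype.ext (mul_add α.1 x.1 y.1)
  add_smul α β x := Subtype.ext (add_mul α.1 β.1 x.1)
  zero_smul x := Subtype.ext (zero_mul x.1)

instance peirceTower (f : R) : IsScalarTower K he.Corner (peirceSubmodule K e f) :=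
  ⟨fun k α x => Subtype.ext (smul_mul_assoc k α.1 x.1)⟩

variable (K) in
/-- Right multiplication by an element of `f R e`, from `e R f` to `e R e`. -/
def peirceMulRight {f : R} (hf : f * f = f) (x : R) (hx : x ∈ peirceBlock f e) :
    peirceSubmodule K e f →ₗ[he.Corner] he.Corner where
  toFun a := ⟨a.1 * x, (Subsemigroup.mem_corner_iff he).2
    ⟨by rw [← mul_assoc, a.2.1], by rw [mul_assoc, ((mem_peirceBlock_iff hf he).1 hx).2]⟩⟩
  map_add' a b := Subtype.ext (add_mul a.1 b.1 x)
  map_smul' α a := Subtype.ext (mul_assoc α.1 a.1 x)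

variable [StarRing K] [TrivialStar K] [StarRing R] [StarModule K R]

variable (K) in
/-- The involution of `e R ē`. -/
def peirceInvolution :
    BimoduleInvolution K he.Corner (peirceSubmodule K e (star e)) where
  σ :=
    { toFun := fun a => ⟨star a.1, by
        have := congrArg star a.2.2
        rwa [star_mul, star_star] at this, by
        have := congrArg star a.2.1
        rwa [star_mul] at this⟩
      map_add' := fun a b => Subtype.ext (star_add a.1 b.1)
      map_smul' := fun k a => Subtype.ext (by
        change star (k • a.1) = k • star a.1
        rw [star_smul, star_trivial]) }
  σ_σ a := Subtype.ext (star_star a.1)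
  σ_smul_σ_smul α β a := Subtype.ext (by
    change star (α.1 * star (β.1 * a.1)) = β.1 * star (α.1 * star a.1)
    simp only [star_mul, star_star, mul_assoc])

/-- Translates the relative theorem with `L = ⊥` to `N = e R ē`; the relation `hxy` says precisely
that `1` lies in `total`. -/
theorem exists_perturbation_of_finite (he : IsIdempotentElem e) [Module.Finite K R] {m : ℕ}
    (hK : BassSerreSmall m (Set.univ : Set (MaximalSpectrum K))) (xm xp ym yp : Fin (m + 1) → R)
    (hxm : ∀ i, xm i ∈ peirceBlock (star e) e) (hxp : ∀ i, xp i ∈ peirceBlock e e)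
    (hym : ∀ i, ym i ∈ peirceBlock e (star e)) (hyp : ∀ i, yp i ∈ peirceBlock e e)
    (hxy : ∑ i, ym i * xm i + ∑ i, yp i * xp i = e) :
    ∃ B : Fin (m + 1) → Fin (m + 1) → R, (∀ i j, B i j ∈ peirceBlock e (star e)) ∧
      IsRightUnimodular e fun i => xp i + ∑ j, (B i j - star (B j i)) * xm j := by
  have hs : star e * star e = star e := by rw [← star_mul, he.eq]
  let z : Fin (m + 1) → he.Corner := fun i => toCorner he (xp i) (hxp i)
  let w : Fin (m + 1) → peirceSubmodule K e (star e) →ₗ[he.Corner] he.Corner :=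
    fun i => peirceMulRight K he hs (xm i) (hxm i)
  obtain ⟨B, hB⟩ := (peirceInvolution K he).isReducible_of_bassSerreSmall m ⊥
    (hK.mono (Set.subset_univ _)) z w (by
      obtain ⟨-, h2, h3⟩ := BimoduleInvolution.le_total ⊥ z w
      rw [Ideal.eq_top_iff_one]
      convert Ideal.add_mem _
        (Ideal.sum_mem _ fun i (_ : i ∈ Finset.univ) =>
          h3 i ⟨ym i, (mem_peirceBlock_iff he hs).1 (hym i)⟩)
        (Ideal.sum_mem _ fun i (_ : i ∈ Finset.univ) =>
          Ideal.mul_mem_left _ (toCorner he (yp i) (hyp i)) (h2 i))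
      refine cornerVal_injective he ?_
      rw [map_add, map_sum, map_sum]
      exact hxy.symm)
  rw [bot_sup_eq, ← isRightUnimodular_iff] at hB
  refine ⟨fun i j => (B i j : R), fun i j => (mem_peirceBlock_iff he hs).2 (B i j).2, ?_⟩
  convert hB using 2 with i
  rw [BimoduleInvolution.perturb, map_add, map_sum]
  rfl

end Corner

/-! ### Passage from finite to quasi-finite algebras. -/

section Transfer

variable {K : Type*} {R : Type v} [CommRing K] [NonUnitalRing R] [StarRing R] [Module K R]

theorem coe_mem_peirceBlock {R₀ : NonUnitalStarSubalgebra K R} {e f x : R₀}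
    (h : x ∈ peirceBlock e f) : (x : R) ∈ peirceBlock (e : R) f := by
  obtain ⟨r, rfl⟩ := h
  exact ⟨r, rfl⟩

theorem mem_peirceBlock_of_coe {R₀ : NonUnitalStarSubalgebra K R} {e f x : R₀}
    (he : e * e = e) (hf : f * f = f) (h : (x : R) ∈ peirceBlock (e : R) f) :
    x ∈ peirceBlock e f := by
  have := (mem_peirceBlock_iff (congrArg Subtype.val he) (congrArg Subtype.val hf)).1 h
  exact (mem_peirceBlock_iff he hf).2 ⟨Subtype.ext this.1, Subtype.ext this.2⟩

theorem IsRightUnimodular.coe {R₀ : NonUnitalStarSubalgebra K R} {e : R₀} {k : ℕ} {x : Fin k → R₀}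
    (h : IsRightUnimodular e x) : IsRightUnimodular (e : R) fun i => (x i : R) := by
  obtain ⟨y, hy, h⟩ := h
  refine ⟨fun i => y i, fun i => coe_mem_peirceBlock (hy i), ?_⟩
  rw [← h]
  simp

variable [StarRing K] [TrivialStar K] [IsScalarTower K R R] [SMulCommClass K R R] [StarModule K R]

theorem stableRankLE_of_isQuasiFinite (hR : IsQuasiFiniteAlgebra K R) {e : R}
    (he : IsIdempotentElem e) {m : ℕ}
    (hK : BassSerreSmall m (Set.univ : Set (MaximalSpectrum K))) : StableRankLE e m := by
  rintro x hx ⟨y, hy, h⟩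
  obtain ⟨R₀, hR₀, hfin⟩ := hR.exists_finite_nonUnitalStarSubalgebra
    ({e} ∪ Set.range x ∪ Set.range y)
    (((Set.finite_singleton e).union (Set.finite_range x)).union (Set.finite_range y))
  have he₀ : e ∈ R₀ := hR₀ (Or.inl (Or.inl rfl))
  lift x to Fin (m + 1) → R₀ using fun i => hR₀ (Or.inl (Or.inr ⟨i, rfl⟩))
  lift y to Fin (m + 1) → R₀ using fun i => hR₀ (Or.inr ⟨i, rfl⟩)
  lift e to R₀ using he₀
  have he' : e * e = e := Subtype.ext he
  obtain ⟨a, ha, hu⟩ := stableRankLE_of_finite (K := K) he' hK x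
    (fun i => mem_peirceBlock_of_coe he' he' (hx i))
    ⟨y, fun i => mem_peirceBlock_of_coe he' he' (hy i), Subtype.ext (by rw [← h]; simp)⟩
  exact ⟨fun i => a i, fun i => coe_mem_peirceBlock (ha i), hu.coe⟩

theorem exists_perturbation_of_isQuasiFinite (hR : IsQuasiFiniteAlgebra K R) {e : R}
    (he : IsIdempotentElem e) {m : ℕ}
    (hK : BassSerreSmall m (Set.univ : Set (MaximalSpectrum K))) (xm xp ym yp : Fin (m + 1) → R)
    (hxm : ∀ i, xm i ∈ peirceBlock (star e) e) (hxp : ∀ i, xp i ∈ peirceBlock e e)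
    (hym : ∀ i, ym i ∈ peirceBlock e (star e)) (hyp : ∀ i, yp i ∈ peirceBlock e e)
    (hxy : ∑ i, ym i * xm i + ∑ i, yp i * xp i = e) :
    ∃ B : Fin (m + 1) → Fin (m + 1) → R, (∀ i j, B i j ∈ peirceBlock e (star e)) ∧
      IsRightUnimodular e fun i => xp i + ∑ j, (B i j - star (B j i)) * xm j := by
  obtain ⟨R₀, hR₀, hfin⟩ := hR.exists_finite_nonUnitalStarSubalgebra
    ({e} ∪ (Set.range xm ∪ Set.range xp ∪ (Set.range ym ∪ Set.range yp)))
    ((Set.finite_singleton e).union (((Set.finite_range _).union (Set.finite_range _)).union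
      ((Set.finite_range _).union (Set.finite_range _))))
  have he₀ : e ∈ R₀ := hR₀ (Or.inl rfl)
  lift xm to Fin (m + 1) → R₀ using fun i => hR₀ (Or.inr (Or.inl (Or.inl ⟨i, rfl⟩)))
  lift xp to Fin (m + 1) → R₀ using fun i => hR₀ (Or.inr (Or.inl (Or.inr ⟨i, rfl⟩)))
  lift ym to Fin (m + 1) → R₀ using fun i => hR₀ (Or.inr (Or.inr (Or.inl ⟨i, rfl⟩)))
  lift yp to Fin (m + 1) → R₀ using fun i => hR₀ (Or.inr (Or.inr (Or.inr ⟨i, rfl⟩)))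
  lift e to R₀ using he₀
  have he' : e * e = e := Subtype.ext he
  have hs : star e * star e = star e := by rw [← star_mul, he']
  obtain ⟨B, hB, hu⟩ := exists_perturbation_of_finite he' hK xm xp ym yp
    (fun i => mem_peirceBlock_of_coe hs he' (hxm i))
    (fun i => mem_peirceBlock_of_coe he' he' (hxp i))
    (fun i => mem_peirceBlock_of_coe he' hs (hym i))
    (fun i => mem_peirceBlock_of_coe he' he' (hyp i))
    (Subtype.ext (by rw [← hxy]; simp))
  refine ⟨fun i j => B i j, fun i j => coe_mem_peirceBlock (hB i j), ?_⟩
  convert hu.coe using 2 with i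
  simp

end Transfer

/-! ### The even form parameter and the conclusion. -/

section Families

variable {R : Type v} {Δ : Type w} [NonUnitalRing R] [StarRing R] [AddGroup Δ]
  {D : OddFormRing R Δ} {n : ℕ}

theorem OrthogonalHyperbolicFamily.esum_mul_ep (F : OrthogonalHyperbolicFamily D n) (s : Fin n) :
    F.esum * (F.pair s).ep = (F.pair s).ep := by
  have h : (F.pair s).eabs * (F.pair s).ep = (F.pair s).ep := by
    rw [HyperbolicPair.eabs, add_mul, (F.pair s).em_mul_ep, (F.pair s).ep_mul_ep, zero_add]
  rw [OrthogonalHyperbolicFamily.esum, Finset.sum_mul, Finset.sum_eq_single s]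
  · exact h
  · intro i _ hi
    rw [← h, ← mul_assoc, (F.orthogonal i s hi).1, zero_mul]
  · simp

theorem OrthogonalHyperbolicFamily.star_esum (F : OrthogonalHyperbolicFamily D n) :
    star F.esum = F.esum := by
  simp only [OrthogonalHyperbolicFamily.esum, star_sum, HyperbolicPair.eabs, star_add]
  refine Finset.sum_congr rfl fun i _ => ?_
  rw [← (F.pair i).star_ep, star_star, add_comm]

/-- The witness is `φ(b)`: it is fixed by the hermitian idempotent `F.esum`, killed by `π`, and sent
to `b - star b` by `ρ`. -/
theorem OrthogonalHyperbolicFamily.sub_star_mem_evenParameter (F : OrthogonalHyperbolicFamily D n)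
    (s : Fin n) {b : R} (hb : b ∈ peirceBlock (F.pair s).ep (F.pair s).em) :
    b - star b ∈ F.evenParameter := by
  have h1 : F.esum * b = b := by
    obtain ⟨r, rfl⟩ := hb
    rw [← mul_assoc, ← mul_assoc, F.esum_mul_ep]
  have h2 : b * F.esum = b := by
    obtain ⟨r, rfl⟩ := hb
    have h := congrArg star (F.esum_mul_ep s)
    rw [star_mul, F.star_esum, (F.pair s).star_ep] at h
    rw [mul_assoc, h]
  have h3 : D.act (D.phi b) F.esum = D.phi b := by
    rw [← D.phi_conj, F.star_esum, h1, h2]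
  exact ⟨D.phi b, by rw [h3, D.pi_phi], by rw [h3, D.rho_phi]⟩

end Families

theorem mainTheorem3 {K : Type u} {R : Type v} {Δ : Type w} [CommRing K] [StarRing K]
    [TrivialStar K] [NonUnitalRing R] [StarRing R] [Module K R] [IsScalarTower K R R]
    [SMulCommClass K R R] [StarModule K R] [AddGroup Δ]
    (D : OddFormAlgebra K R Δ) (hD : D.IsQuasiFinite)
    {n : ℕ} (hn : 1 ≤ n) (F : OrthogonalHyperbolicFamily D.toOddFormRing n) (hF : F.IsFree)
    (d : WithBot ℕ∞) (hd : BassSerreDimLE K d) :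
    F.LambdaStableRankLE ⟨0, hn⟩ (dimSucc d) := by
  intro m hm
  have hK := hd.bassSerreSmall_univ hm
  have he : IsIdempotentElem (F.pair ⟨0, hn⟩).ep := (F.pair ⟨0, hn⟩).ep_mul_ep
  refine ⟨stableRankLE_of_isQuasiFinite hD he hK, ?_⟩
  rintro xm xp hxm hxp ⟨ym, yp, hym, hyp, hxy⟩
  have hstar := (F.pair ⟨0, hn⟩).star_ep
  rw [← hstar] at hxm hym
  obtain ⟨B, hB, hu⟩ := exists_perturbation_of_isQuasiFinite hD he hK xm xp ym yp hxm hxp hym hyp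
    hxy
  refine ⟨fun i j => B i j - star (B j i), fun i j => ?_, fun i j => ?_, fun i => ?_, hu⟩
  · obtain ⟨r, hr⟩ := hB i j
    obtain ⟨r', hr'⟩ := hB j i
    refine ⟨r - star r', ?_⟩
    change B i j - star (B j i) = _
    rw [hr, hr', star_mul, star_mul, star_star, hstar, mul_sub, sub_mul, mul_assoc _ (star r')]
  · rw [star_sub, star_star, neg_sub]
  · refine F.sub_star_mem_evenParameter ⟨0, hn⟩ ?_
    rw [← hstar]
    exact hB i i
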